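/- Let $\Bbbk\in\{\mathbb R,\mathbb C\}$ and let $X$ be a Hausdorff space that is locally paracompact, i.e. every point has a closed paracompact neighborhood. An (F) Banach bundle over $X$ is a continuous open map $\pi:\mathcal E\to X$ whose fibers $\mathcal E_x=\pi^{-1}(x)$ are Banach spaces over $\Bbbk$, such that addition $\mathcal E\times_X\mathcal E\to\mathcal E$, scalar multiplication $\Bbbk\times\mathcal E\to\mathcal E$ and the norm $\mathcal E\to\mathbb R_{\ge 0}$ are continuous, and such that for each $x\in X$ the sets $\{p\in\mathcal E : \pi(p)\in U,\ \|p\|<\varepsilon\}$ ($U$ a neighborhood of $x$, $\varepsilon>0$) form a neighborhood basis of $0_x\in\mathcal E_x$. It is $n$-homogeneous if all fibers have dimension $n$ ($n\in\mathbb Z_{\ge 0}$), and a Hilbert bundle if all fiber norms come from inner products. Write $\Gamma_b(\mathcal E)$ for the Banach $C_b(X)$-module of bounded continuous sections of $\mathcal E$ with the supremum norm. A renorming $\mathcal E\cong\mathcal E'$ is a homeomorphism over $X$ that is linear on each fiber, and the bounded Banach–Mazur distance is $$d_{b\mathrm{BM}}(\mathcal E,\mathcal E')=\log\inf_T\|T\|\cdot\|T^{-1}\|\in[-\infty,\infty],$$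 where $T$ ranges over the Banach $C_b(X)$-module isomorphisms $\Gamma_b(\mathcal E)\to\Gamma_b(\mathcal E')$ induced by renormings ($\log 0=-\infty$, $\inf\emptyset=\infty$). Let $\mathcal E\to X$ be an $n$-homogeneous (F) Banach bundle. Then: 1. For each $x\in X$ there is a unique ellipsoid of minimal volume containing the closed unit ball of $\mathcal E_x$ (its Löwner ellipsoid; ellipsoids are the images of the closed Euclidean unit ball of $\Bbbk^n$ under invertible $\Bbbk$-affine maps $\Bbbk^n\to\mathcal E_x$). These ellipsoids are the closed unit balls of fiber norms that make the same total space, with the same topology and linear structure, into an (F) Hilbert bundle $\mathcal E^L\to X$. 2. $\Gamma_b(\mathcal E)$ and $\Gamma_b(\mathcal E^L)$ consist of the same sections, and the identity $T:\Gamma_b(\mathcal E)\to\Gamma_b(\mathcal E^L)$ is an isomorphism of Banach $C_b(X)$-modules with $\|T\|\cdot\|T^{-1}\|\le\sqrt n$. 3. Consequently $d_{b\mathrm{BM}}(\mathcal E,\mathcal E^L)\le\tfrac12\log n$, and in particular $$\inf\{d_{b\mathrm{BM}}(\mathcal E,\mathcal E') : \mathcal E'\to X\ \text{an $n$-homogeneous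 (F) Hilbert bundle}\}\le\tfrac12\log n.$$ -/

import Mathlib

open Bundle Topology Filter
open scoped BoundedContinuousFunction ENNReal

universe w u v

/-- Every point has a closed paracompact neighbourhood. -/
def LocallyParacompact (X : Type u) [TopologicalSpace X] : Prop :=
  ∀ x : X, ∃ K ∈ 𝓝 x, IsClosed K ∧ ParacompactSpace K

/-! ### Ellipsoids and Löwner ellipsoids -/

section Ellipsoids

variable (𝕜 : Type w) [RCLike 𝕜] {V : Type v} [AddCommGroup V] [Module 𝕜 V]

/-- An ellipsoid in a `𝕜`-vector space `V` of dimension `d`: the image of the closed Euclidean unit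
ball of `𝕜 ^ d` under an invertible `𝕜`-affine map. -/
def IsEllipsoid (L : Set V) : Prop :=
  ∃ f : EuclideanSpace 𝕜 (Fin (Module.finrank 𝕜 V)) ≃ᵃ[𝕜] V, L = f '' Metric.closedBall 0 1

/-- `L` is a volume-minimizing ellipsoid containing `K`. Volumes are Lebesgue (Haar) measures
read off in linear coordinates; a change of coordinates multiplies all of them by a constant. -/
def IsLownerEllipsoid (K L : Set V) : Prop :=
  IsEllipsoid 𝕜 L ∧ K ⊆ L ∧
    ∀ L' : Set V, IsEllipsoid 𝕜 L' → K ⊆ L' →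
      ∀ φ : V ≃ₗ[𝕜] EuclideanSpace 𝕜 (Fin (Module.finrank 𝕜 V)),
        MeasureTheory.Measure.addHaar (φ '' L) ≤ MeasureTheory.Measure.addHaar (φ '' L')

end Ellipsoids

/-! ### Banach bundles -/

/-- A bundle of `𝕜`-linear spaces over `X`: a family of vector spaces with a topology on the total
space for which the projection is continuous and open and the fibrewise operations are
continuous (`Fiber ×ᵇ Fiber` carries the subspace topology of the fibre product).
The first argument of `TotalSpace` is a dummy. -/
structure LinearBundle (𝕜 : Type w) [RCLike 𝕜] (X : Type u) [TopologicalSpace X] where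
  Fiber : X → Type v
  [addCommGroup : ∀ x, AddCommGroup (Fiber x)]
  [module : ∀ x, Module 𝕜 (Fiber x)]
  [topology : TopologicalSpace (TotalSpace Unit Fiber)]
  continuous_proj : Continuous (TotalSpace.proj : TotalSpace Unit Fiber → X)
  isOpenMap_proj : IsOpenMap (TotalSpace.proj : TotalSpace Unit Fiber → X)
  continuous_add : Continuous fun p : TotalSpace (Unit × Unit) (Fiber ×ᵇ Fiber) =>
    (⟨p.proj, p.snd.1 + p.snd.2⟩ : TotalSpace Unit Fiber)
  continuous_smul : Continuous fun p : 𝕜 × TotalSpace Unit Fiber =>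
    (⟨p.2.proj, p.1 • p.2.snd⟩ : TotalSpace Unit Fiber)

attribute [instance] LinearBundle.addCommGroup LinearBundle.module LinearBundle.topology

section Bundles

variable {𝕜 : Type w} [RCLike 𝕜] {X : Type u} [TopologicalSpace X]

/-- The total space. -/
abbrev LinearBundle.Total (E : LinearBundle.{w, u, v} 𝕜 X) : Type (max u v) :=
  TotalSpace Unit E.Fiber

/-- All fibres are `n`-dimensional. -/
def LinearBundle.IsHomogeneous (E : LinearBundle.{w, u, v} 𝕜 X) (n : ℕ) : Prop :=
  ∀ x, Module.Finite 𝕜 (E.Fiber x) ∧ Module.finrank 𝕜 (E.Fiber x) = n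

/-- A fibrewise norm making the bundle `E` a continuous, i.e. (F), Banach bundle: the fibres are
Banach spaces, the norm is continuous on the total space, and the tubes
`{p | π p ∈ U, ‖p‖ < ε}` form a basis of neighbourhoods of the zero of each fibre. -/
structure BanachNorm (E : LinearBundle.{w, u, v} 𝕜 X) where
  nrm : ∀ x, Seminorm 𝕜 (E.Fiber x)
  eq_zero : ∀ x v, nrm x v = 0 → v = 0
  complete : ∀ x (a : ℕ → E.Fiber x),
    (∀ ε : ℝ, 0 < ε → ∃ M, ∀ i ≥ M, ∀ j ≥ M, nrm x (a i - a j) < ε) →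
      ∃ l, Tendsto (fun i => nrm x (a i - l)) atTop (𝓝 0)
  continuous_nrm : Continuous fun p : E.Total => nrm p.proj p.snd
  nhds_zero : ∀ x, (𝓝 (⟨x, 0⟩ : E.Total)).HasBasis
    (fun B : Set X × ℝ => B.1 ∈ 𝓝 x ∧ 0 < B.2)
    (fun B => {p : E.Total | p.proj ∈ B.1 ∧ nrm p.proj p.snd < B.2})

/-- The closed unit ball of the fibre at `x`. -/
def BanachNorm.unitBall {E : LinearBundle.{w, u, v} 𝕜 X} (N : BanachNorm E) (x : X) :
    Set (E.Fiber x) :=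
  {v | N.nrm x v ≤ 1}

/-- The Banach bundle is a Hilbert bundle: all fibre norms come from inner products. -/
def BanachNorm.IsHilbert {E : LinearBundle.{w, u, v} 𝕜 X} (N : BanachNorm E) : Prop :=
  ∀ x, ∃ c : InnerProductSpace.Core 𝕜 (E.Fiber x),
    ∀ v, N.nrm x v = Real.sqrt (RCLike.re (c.inner v v))

/-! ### Bounded sections -/

theorem LinearBundle.continuous_zero_section (E : LinearBundle.{w, u, v} 𝕜 X) :
    Continuous fun x => (⟨x, 0⟩ : E.Total) := by
  have hq : IsQuotientMap (TotalSpace.proj : E.Total → X) :=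
    E.isOpenMap_proj.isQuotientMap E.continuous_proj fun x => ⟨⟨x, 0⟩, rfl⟩
  rw [hq.continuous_iff]
  have h := E.continuous_smul.comp
    (Continuous.prodMk (continuous_const (y := (0 : 𝕜))) (continuous_id (X := E.Total)))
  simpa [Function.comp_def] using h

theorem LinearBundle.continuous_add_section (E : LinearBundle.{w, u, v} 𝕜 X)
    {s t : ∀ x, E.Fiber x} (hs : Continuous fun x => (⟨x, s x⟩ : E.Total))
    (ht : Continuous fun x => (⟨x, t x⟩ : E.Total)) :
    Continuous fun x => (⟨x, s x + t x⟩ : E.Total) := by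
  have h : Continuous fun x =>
      (⟨x, (s x, t x)⟩ : TotalSpace (Unit × Unit) (E.Fiber ×ᵇ E.Fiber)) :=
    continuous_induced_rng.2 (hs.prodMk ht)
  exact E.continuous_add.comp h

theorem LinearBundle.continuous_smul_section (E : LinearBundle.{w, u, v} 𝕜 X)
    {f : X → 𝕜} {s : ∀ x, E.Fiber x} (hf : Continuous f)
    (hs : Continuous fun x => (⟨x, s x⟩ : E.Total)) :
    Continuous fun x => (⟨x, f x • s x⟩ : E.Total) :=
  E.continuous_smul.comp (hf.prodMk hs)

theorem bddAbove_smul_section {E : LinearBundle.{w, u, v} 𝕜 X} (N : BanachNorm E)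
    {f : X → 𝕜} {s : ∀ x, E.Fiber x} {C : ℝ} (hf : ∀ x, ‖f x‖ ≤ C)
    (hs : BddAbove (Set.range fun x => N.nrm x (s x))) :
    BddAbove (Set.range fun x => N.nrm x (f x • s x)) := by
  obtain ⟨D, hD⟩ := hs
  refine ⟨C * D, ?_⟩
  rintro _ ⟨x, rfl⟩
  have h1 : N.nrm x (s x) ≤ D := hD ⟨x, rfl⟩
  simp only [map_smul_eq_mul]
  exact mul_le_mul (hf x) h1 (apply_nonneg _ _) ((norm_nonneg _).trans (hf x))

/-- `Γ_b`: the bounded continuous sections. -/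
def bddSections {E : LinearBundle.{w, u, v} 𝕜 X} (N : BanachNorm E) :
    Submodule 𝕜 (∀ x, E.Fiber x) where
  carrier := {s | Continuous (fun x => (⟨x, s x⟩ : E.Total)) ∧
    BddAbove (Set.range fun x => N.nrm x (s x))}
  zero_mem' := ⟨E.continuous_zero_section, ⟨0, by rintro _ ⟨x, rfl⟩; simp⟩⟩
  add_mem' := by
    rintro s t ⟨hs, C, hC⟩ ⟨ht, D, hD⟩
    refine ⟨E.continuous_add_section hs ht, C + D, ?_⟩
    rintro _ ⟨x, rfl⟩
    exact (map_add_le_add (N.nrm x) _ _).trans (add_le_add (hC ⟨x, rfl⟩) (hD ⟨x, rfl⟩))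
  smul_mem' := by
    rintro c s ⟨hs, hb⟩
    exact ⟨E.continuous_smul_section continuous_const hs,
      bddAbove_smul_section N (f := fun _ => c) (fun _ => le_rfl) hb⟩

variable {E : LinearBundle.{w, u, v} 𝕜 X}

/-- `Γ_b` as a module over the algebra `C_b(X)`. -/
instance bddSectionsModule (N : BanachNorm E) : Module (X →ᵇ 𝕜) (bddSections N) where
  smul f s := ⟨fun x => f x • s.1 x, E.continuous_smul_section f.continuous s.2.1,
    bddAbove_smul_section N f.norm_coe_le_norm s.2.2⟩
  one_smul s := Subtype.ext (funext fun x => one_smul 𝕜 (s.1 x))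
  mul_smul f g s := Subtype.ext (funext fun x => mul_smul (f x) (g x) (s.1 x))
  smul_zero f := Subtype.ext (funext fun x => smul_zero (f x))
  smul_add f s t := Subtype.ext (funext fun x => smul_add (f x) (s.1 x) (t.1 x))
  add_smul f g s := Subtype.ext (funext fun x => add_smul (f x) (g x) (s.1 x))
  zero_smul s := Subtype.ext (funext fun x => zero_smul 𝕜 (s.1 x))

instance bddSectionsScalarTower (N : BanachNorm E) : IsScalarTower 𝕜 (X →ᵇ 𝕜) (bddSections N) where
  smul_assoc c f s := Subtype.ext (funext fun x => smul_assoc c (f x) (s.1 x))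

/-- The supremum norm on `Γ_b`. -/
noncomputable def bddSectionsNorm (N : BanachNorm E) : AddGroupNorm (bddSections N) where
  toFun s := ⨆ x, N.nrm x (s.1 x)
  map_zero' := by simp
  add_le' s t := by
    refine Real.iSup_le (fun x => ?_) (add_nonneg
      (Real.iSup_nonneg fun x => apply_nonneg _ _) (Real.iSup_nonneg fun x => apply_nonneg _ _))
    exact (map_add_le_add (N.nrm x) _ _).trans
      (add_le_add (le_ciSup s.2.2 x) (le_ciSup t.2.2 x))
  neg' s := by simp
  eq_zero_of_map_eq_zero' s h := by
    refine Subtype.ext (funext fun x => N.eq_zero x _ (le_antisymm ?_ (apply_nonneg _ _)))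
    exact (le_ciSup s.2.2 x).trans h.le

noncomputable instance bddSectionsNormedAddCommGroup (N : BanachNorm E) : NormedAddCommGroup (bddSections N) :=
  (bddSectionsNorm N).toNormedAddCommGroup

theorem bddSections_norm_def (N : BanachNorm E) (s : bddSections N) :
    ‖s‖ = ⨆ x, N.nrm x (s.1 x) := rfl

noncomputable instance bddSectionsNormedSpace (N : BanachNorm E) : NormedSpace 𝕜 (bddSections N) where
  norm_smul_le c s := by
    rw [bddSections_norm_def, bddSections_norm_def]
    refine Real.iSup_le (fun x => ?_)
      (mul_nonneg (norm_nonneg _) (Real.iSup_nonneg fun x => apply_nonneg _ _))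
    have h : N.nrm x ((c • s : bddSections N).1 x) = ‖c‖ * N.nrm x (s.1 x) :=
      map_smul_eq_mul (N.nrm x) c (s.1 x)
    rw [h]
    exact mul_le_mul_of_nonneg_left (le_ciSup s.2.2 x) (norm_nonneg _)

/-! ### Renormings and the bounded Banach-Mazur distance -/

/-- An equivalence of bundles over `X`: a homeomorphism of total spaces covering the identity of `X`
and linear on each fibre. -/
structure Renorming (E E' : LinearBundle.{w, u, v} 𝕜 X) where
  fiberEquiv : ∀ x, E.Fiber x ≃ₗ[𝕜] E'.Fiber x
  continuous_toFun :
    Continuous fun p : E.Total => (⟨p.proj, fiberEquiv p.proj p.snd⟩ : E'.Total)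
  continuous_invFun :
    Continuous fun p : E'.Total => (⟨p.proj, (fiberEquiv p.proj).symm p.snd⟩ : E.Total)

/-- The operator norm of a bounded `C_b(X)`-linear map between spaces of bounded sections. -/
noncomputable def sectionsOpNorm {E E' : LinearBundle.{w, u, v} 𝕜 X} {N : BanachNorm E}
    {N' : BanachNorm E'} (T : bddSections N →L[X →ᵇ 𝕜] bddSections N') : ℝ :=
  ‖(T.restrictScalars 𝕜 : bddSections N →L[𝕜] bddSections N')‖

/-- `‖T‖ * ‖T⁻¹‖` for an isomorphism `T` of Banach `C_b(X)`-modules. -/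
noncomputable def distortion {E E' : LinearBundle.{w, u, v} 𝕜 X} {N : BanachNorm E}
    {N' : BanachNorm E'} (T : bddSections N ≃L[X →ᵇ 𝕜] bddSections N') : ℝ :=
  sectionsOpNorm (T : bddSections N →L[X →ᵇ 𝕜] bddSections N') *
    sectionsOpNorm (T.symm : bddSections N' →L[X →ᵇ 𝕜] bddSections N)

/-- The bounded Banach-Mazur distance: the logarithm (with values in `[-∞, ∞]`) of the infimum of
`‖T‖ * ‖T⁻¹‖` over the Banach `C_b(X)`-module isomorphisms `T` induced by renormings. -/
noncomputable def bddBanachMazurDist {E E' : LinearBundle.{w, u, v} 𝕜 X} (N : BanachNorm E)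
    (N' : BanachNorm E') : EReal :=
  ENNReal.log (⨅ (e : Renorming E E') (T : bddSections N ≃L[X →ᵇ 𝕜] bddSections N')
    (_ : ∀ s x, (T s).1 x = e.fiberEquiv x (s.1 x)), ENNReal.ofReal (distortion T))

end Bundles

/-! ### Extremal linear maps into Euclidean space -/

/-! An ellipsoid centred at `0` and containing the unit ball of a norm `p` is `{‖B v‖ ≤ 1}` for an
invertible linear `B` into Euclidean space with `‖B v‖ ≤ p v`, and its volume is inversely
proportional to a power of `|det B|`. Minimizing volume therefore means maximizing the determinant
among dominated maps. A maximizer exists by compactness (`exists_isExtremal`).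

Everything about a maximizer `B` comes from one variation. If `C` is dominated, so is the Euclidean
norm with square `(1 - s)‖B v‖² + s‖C v‖²`. Its determinant relative to `B` is at most `1`, and
differentiating at `s = 0` bounds the squared Hilbert–Schmidt norm of `C B⁻¹` by `n`
(`IsExtremal.exists_diagonal`). Rank-one maps `C` then give `p ≤ √n ‖B ·‖`. When `C` is a second
maximizer, equality in AM–GM gives `‖C v‖ = ‖B v‖`. Off-centre ellipsoids are strictly worse for `n
> 0`: by the parallelogram law they can be recentred and shrunk.

For the bundle, only continuity of `‖B_x v‖` on the total space needs work. Norms converging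
pointwise on a fixed `𝕜 ^ n` have converging extremal Euclidean norms, by compactness and uniqueness
(`tendsto_norm_of_isExtremal`). Openness of the projection supplies nearby frames that pull
neighbouring fibres back to `𝕜 ^ n`. The fibrewise bounds `‖B v‖ ≤ p v ≤ √n ‖B v‖` then pass to the
supremum norms. -/

section Extremal

variable {𝕜 : Type w} [RCLike 𝕜] {n : ℕ}

/-- Diagonalization of the quadratic form `‖D v‖ ^ 2` in an orthonormal basis. -/
theorem exists_orthonormalBasis_norm_sq_eq
    (D : EuclideanSpace 𝕜 (Fin n) →ₗ[𝕜] EuclideanSpace 𝕜 (Fin n)) :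
    ∃ (b : OrthonormalBasis (Fin n) 𝕜 (EuclideanSpace 𝕜 (Fin n))) (d : Fin n → ℝ),
      (∀ i, 0 ≤ d i) ∧ (∀ v, ‖D v‖ ^ 2 = ∑ i, d i * ‖b.repr v i‖ ^ 2) ∧
        ‖LinearMap.det D‖ ^ 2 = ∏ i, d i := by
  have hn : Module.finrank 𝕜 (EuclideanSpace 𝕜 (Fin n)) = n := finrank_euclideanSpace_fin
  have hS := D.isSymmetric_adjoint_comp_self
  refine ⟨hS.eigenvectorBasis hn, hS.eigenvalues hn,
    D.isPositive_adjoint_comp_self.nonneg_eigenvalues hn, fun v => ?_, ?_⟩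
  · have h1 : (‖D v‖ ^ 2 : ℝ) = RCLike.re (inner 𝕜 v (D.adjoint (D v))) := by
      rw [LinearMap.adjoint_inner_right, inner_self_eq_norm_sq]
    rw [h1, ← (hS.eigenvectorBasis hn).repr.inner_map_map, PiLp.inner_apply, map_sum]
    refine Finset.sum_congr rfl fun i _ => ?_
    have h2 := hS.eigenvectorBasis_apply_self_apply hn v i
    rw [LinearMap.comp_apply] at h2
    rw [h2, RCLike.inner_apply, mul_assoc, RCLike.mul_conj, ← RCLike.ofReal_pow,
      ← RCLike.ofReal_mul, RCLike.ofReal_re]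
  · rw [← D.normDet_eq_norm_det, ← RCLike.ofReal_inj (K := 𝕜), D.normDet_sq,
      hS.det_eq_prod_eigenvalues hn, RCLike.ofReal_prod]

/-- A linear map which is diagonal in a given orthonormal basis. -/
theorem exists_linearMap_diagonal
    (b : OrthonormalBasis (Fin n) 𝕜 (EuclideanSpace 𝕜 (Fin n))) (r : Fin n → ℝ) :
    ∃ C : EuclideanSpace 𝕜 (Fin n) →ₗ[𝕜] EuclideanSpace 𝕜 (Fin n),
      (∀ v, ‖C v‖ ^ 2 = ∑ i, r i ^ 2 * ‖b.repr v i‖ ^ 2) ∧ ‖LinearMap.det C‖ = ∏ i, |r i| := by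
  refine ⟨Matrix.toLin b.toBasis b.toBasis (Matrix.diagonal fun i => (r i : 𝕜)), fun v => ?_, ?_⟩
  · rw [← b.repr.norm_map, EuclideanSpace.norm_sq_eq]
    refine Finset.sum_congr rfl fun i _ => ?_
    have h : b.repr (Matrix.toLin b.toBasis b.toBasis (Matrix.diagonal fun i => (r i : 𝕜)) v) i
        = r i * b.repr v i := by
      have := congrFun (Matrix.repr_toLin b.toBasis b.toBasis
        (Matrix.diagonal fun i => (r i : 𝕜)) v) i
      simpa [Matrix.mulVec_diagonal] using this
    rw [h, norm_mul, mul_pow, RCLike.norm_ofReal, sq_abs]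
  · rw [LinearMap.det_toLin, Matrix.det_diagonal, norm_prod]
    simp

/-- The sum is the derivative at `s = 0` of the logarithm of the product. Instead of
differentiating, `1 - 1 / y ≤ log y` is summed, divided by `s`, and the limit `s → 0⁺` is taken; `-1
≤ x i` keeps every factor positive for `s < 1`. -/
theorem sum_le_of_prod_one_add_mul_le_one {ι : Type*} [Fintype ι] {x : ι → ℝ}
    (hx : ∀ i, -1 ≤ x i) (h : ∀ s : ℝ, 0 < s → s < 1 → ∏ i, (1 + s * x i) ≤ 1) :
    ∑ i, x i ≤ 0 := by
  have key : ∀ s : ℝ, 0 < s → s < 1 → ∑ i, x i / (1 + s * x i) ≤ 0 := by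
    intro s h0 h1
    have hpos : ∀ i, 0 < 1 + s * x i := fun i => by nlinarith [hx i]
    have h2 : ∑ i, Real.log (1 + s * x i) ≤ 0 := by
      rw [← Real.log_prod fun i _ => (hpos i).ne']
      exact Real.log_nonpos (Finset.prod_nonneg fun i _ => (hpos i).le) (h s h0 h1)
    have h3 : s * ∑ i, x i / (1 + s * x i) ≤ ∑ i, Real.log (1 + s * x i) := by
      rw [Finset.mul_sum]
      refine Finset.sum_le_sum fun i _ => ?_
      refine le_trans (le_of_eq ?_) (Real.one_sub_inv_le_log_of_pos (hpos i))
      have := (hpos i).ne'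
      field_simp
      ring
    exact nonpos_of_mul_nonpos_right (h3.trans h2) h0
  have hlim : Tendsto (fun s : ℝ => ∑ i, x i / (1 + s * x i)) (𝓝[>] 0)
      (𝓝 (∑ i, x i / (1 + 0 * x i))) := by
    refine tendsto_finsetSum _ fun i _ => Tendsto.div tendsto_const_nhds ?_ (by simp)
    exact ((continuous_const.add (continuous_id.mul continuous_const)).tendsto 0).mono_left
      nhdsWithin_le_nhds
  have := le_of_tendsto hlim (by
    filter_upwards [Ioo_mem_nhdsGT (zero_lt_one' ℝ)] with s hs using key s hs.1 hs.2)
  simpa using this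

variable {V : Type v} [AddCommGroup V] [Module 𝕜 V]

/-- The linear maps into Euclidean space whose norm is dominated by the seminorm `p`. -/
def Dominated {W : Type*} [AddCommGroup W] [Module 𝕜 W] (p : Seminorm 𝕜 W)
    (B : W →ₗ[𝕜] EuclideanSpace 𝕜 (Fin n)) : Prop :=
  ∀ v, ‖B v‖ ≤ p v

/-- `B` has the largest determinant among the linear maps dominated by `p`. -/
structure IsExtremal (p : Seminorm 𝕜 V) (B : V ≃ₗ[𝕜] EuclideanSpace 𝕜 (Fin n)) : Prop where
  dominated : Dominated p (B : V →ₗ[𝕜] EuclideanSpace 𝕜 (Fin n))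
  norm_det_le_one : ∀ C : V →ₗ[𝕜] EuclideanSpace 𝕜 (Fin n), Dominated p C →
    ‖LinearMap.det (C ∘ₗ (B.symm : EuclideanSpace 𝕜 (Fin n) →ₗ[𝕜] V))‖ ≤ 1

theorem IsExtremal.comp {W : Type*} [AddCommGroup W] [Module 𝕜 W] {p : Seminorm 𝕜 V}
    {B : V ≃ₗ[𝕜] EuclideanSpace 𝕜 (Fin n)} (h : IsExtremal p B) (A : W ≃ₗ[𝕜] V) :
    IsExtremal (p.comp (A : W →ₗ[𝕜] V)) (A.trans B) := by
  refine ⟨fun v => h.dominated (A v), fun C hC => ?_⟩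
  have := h.norm_det_le_one (C ∘ₗ (A.symm : V →ₗ[𝕜] W)) fun v => by
    simpa using hC (A.symm v)
  exact this

/-- The Hilbert-Schmidt norm of a dominated map, relative to the extremal one, is at most `√n`. -/
theorem IsExtremal.exists_diagonal {p : Seminorm 𝕜 V} {B : V ≃ₗ[𝕜] EuclideanSpace 𝕜 (Fin n)}
    (h : IsExtremal p B) {C : V →ₗ[𝕜] EuclideanSpace 𝕜 (Fin n)} (hC : Dominated p C) :
    ∃ (b : OrthonormalBasis (Fin n) 𝕜 (EuclideanSpace 𝕜 (Fin n))) (d : Fin n → ℝ),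
      (∀ i, 0 ≤ d i) ∧ (∀ v, ‖C v‖ ^ 2 = ∑ i, d i * ‖b.repr (B v) i‖ ^ 2) ∧
      ‖LinearMap.det (C ∘ₗ (B.symm : EuclideanSpace 𝕜 (Fin n) →ₗ[𝕜] V))‖ ^ 2 = ∏ i, d i ∧
      ∑ i, d i ≤ n := by
  obtain ⟨b, d, hd, hCd, hdet⟩ := exists_orthonormalBasis_norm_sq_eq
    (C ∘ₗ (B.symm : EuclideanSpace 𝕜 (Fin n) →ₗ[𝕜] V))
  have hCd' : ∀ v, ‖C v‖ ^ 2 = ∑ i, d i * ‖b.repr (B v) i‖ ^ 2 := fun v => by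
    rw [← hCd (B v)]; simp
  refine ⟨b, d, hd, hCd', hdet, ?_⟩
  have hsum : ∑ i, (d i - 1) ≤ 0 := by
    refine sum_le_of_prod_one_add_mul_le_one (fun i => by linarith [hd i]) fun s h0 h1 => ?_
    have hpos : ∀ i, 0 ≤ 1 + s * (d i - 1) := fun i => by nlinarith [hd i]
    -- `G` is chosen so that `‖G (B v)‖² = (1 - s)‖B v‖² + s‖C v‖²`. This interpolation is again
    -- dominated by `p`, so `|det G| ≤ 1`.
    obtain ⟨G, hG, hGdet⟩ := exists_linearMap_diagonal b fun i => √(1 + s * (d i - 1))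
    have hGB : Dominated p (G ∘ₗ (B : V →ₗ[𝕜] EuclideanSpace 𝕜 (Fin n))) := fun v => by
      refine abs_le_of_sq_le_sq' ?_ (apply_nonneg p v) |>.2
      have e1 : ‖G (B v)‖ ^ 2 = (1 - s) * ‖B v‖ ^ 2 + s * ‖C v‖ ^ 2 := by
        rw [hG, hCd', ← b.repr.norm_map (B v), EuclideanSpace.norm_sq_eq, Finset.mul_sum,
          Finset.mul_sum, ← Finset.sum_add_distrib]
        refine Finset.sum_congr rfl fun i _ => ?_
        rw [Real.sq_sqrt (hpos i)]
        ring
      have e2 : ‖B v‖ ^ 2 ≤ p v ^ 2 := pow_le_pow_left₀ (norm_nonneg _) (h.dominated v) 2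
      have e3 : ‖C v‖ ^ 2 ≤ p v ^ 2 := pow_le_pow_left₀ (norm_nonneg _) (hC v) 2
      change ‖G (B v)‖ ^ 2 ≤ _
      rw [e1]
      nlinarith
    have h2 := h.norm_det_le_one _ hGB
    have e : (G ∘ₗ (B : V →ₗ[𝕜] EuclideanSpace 𝕜 (Fin n))) ∘ₗ
        (B.symm : EuclideanSpace 𝕜 (Fin n) →ₗ[𝕜] V) = G := by
      ext1 v; simp
    rw [e, hGdet] at h2
    have h3 : ∏ i, (1 + s * (d i - 1)) = (∏ i, |√(1 + s * (d i - 1))|) ^ 2 := by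
      rw [← Finset.prod_pow]
      exact Finset.prod_congr rfl fun i _ => by rw [sq_abs, Real.sq_sqrt (hpos i)]
    rw [h3]
    exact pow_le_one₀ (Finset.prod_nonneg fun i _ => abs_nonneg _) h2
  simpa using hsum

/-- Hahn–Banach gives a functional `f` with `|f| ≤ p` that attains `p v` at `v`. Placed along one
coordinate axis it is a dominated rank-one map, and the bound `∑ d i ≤ n` applied to it gives `p v ^
2 ≤ n ‖B v‖ ^ 2`. A coordinate axis exists only for `n > 0`. -/
theorem IsExtremal.le_sqrt_mul {p : Seminorm 𝕜 V} {B : V ≃ₗ[𝕜] EuclideanSpace 𝕜 (Fin n)}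
    (h : IsExtremal p B) (v : V) : p v ≤ √n * ‖B v‖ := by
  rcases Nat.eq_zero_or_pos n with rfl | hn
  · have : v = 0 := B.injective (Subsingleton.elim _ _)
    simp [this]
  obtain ⟨f, hf, hfp⟩ : ∃ f : V →ₗ[𝕜] 𝕜, f v = p v ∧ ∀ w, ‖f w‖ ≤ p w := by
    rcases eq_or_ne v 0 with rfl | hv
    · exact ⟨0, by simp⟩
    · let e := LinearEquiv.toSpanNonzeroSingleton 𝕜 V v hv
      have he : ∀ c, (e c : V) = c • v := fun c => rfl
      obtain ⟨g, hg, hgp⟩ := Module.Dual.exists_extension_of_le_seminorm (p := p)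
        (𝕜 ∙ v) ((p v : 𝕜) • (e.symm : (𝕜 ∙ v) →ₗ[𝕜] 𝕜)) fun x => by
          obtain ⟨c, rfl⟩ := e.surjective x
          rw [LinearMap.smul_apply, LinearEquiv.coe_coe, e.symm_apply_apply, he,
            map_smul_eq_mul, norm_smul, mul_comm, RCLike.norm_ofReal,
            abs_of_nonneg (apply_nonneg p v)]
      refine ⟨g, ?_, hgp⟩
      have h1 := hg (e 1)
      rw [LinearMap.smul_apply, LinearEquiv.coe_coe, e.symm_apply_apply, he, one_smul] at h1
      simpa using h1
  obtain ⟨b, d, hd, hCd, -, hsum⟩ := h.exists_diagonal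
    (C := f.smulRight (EuclideanSpace.single (⟨0, hn⟩ : Fin n) (1 : 𝕜))) fun w => by
      simpa [norm_smul] using hfp w
  have h1 := hCd v
  simp only [LinearMap.smulRight_apply, norm_smul, hf, PiLp.norm_single, norm_one,
    mul_one, RCLike.norm_ofReal, sq_abs] at h1
  have h2 : ∑ i, d i * ‖b.repr (B v) i‖ ^ 2 ≤ ∑ i, d i * ‖B v‖ ^ 2 := by
    refine Finset.sum_le_sum fun i _ => mul_le_mul_of_nonneg_left ?_ (hd i)
    rw [← b.repr.norm_map (B v), EuclideanSpace.norm_sq_eq]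
    exact Finset.single_le_sum (f := fun i => ‖b.repr (B v) i‖ ^ 2) (fun _ _ => sq_nonneg _)
      (Finset.mem_univ i)
  rw [← Finset.sum_mul] at h2
  refine abs_le_of_sq_le_sq' ?_ (by positivity) |>.2
  rw [h1, mul_pow, Real.sq_sqrt (Nat.cast_nonneg n)]
  exact h2.trans (mul_le_mul_of_nonneg_right hsum (sq_nonneg _))

/-- An extremal map is unique up to isometries. -/
theorem IsExtremal.norm_eq {p : Seminorm 𝕜 V} {B C : V ≃ₗ[𝕜] EuclideanSpace 𝕜 (Fin n)}
    (hB : IsExtremal p B) (hC : IsExtremal p C) (v : V) : ‖C v‖ = ‖B v‖ := by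
  obtain ⟨b, d, hd, hCd, hdet, hsum⟩ := hB.exists_diagonal hC.dominated
  have h1 := hB.norm_det_le_one _ hC.dominated
  have h2 := hC.norm_det_le_one _ hB.dominated
  have h3 : LinearMap.det ((C : V →ₗ[𝕜] EuclideanSpace 𝕜 (Fin n)) ∘ₗ
      (B.symm : EuclideanSpace 𝕜 (Fin n) →ₗ[𝕜] V)) *
      LinearMap.det ((B : V →ₗ[𝕜] EuclideanSpace 𝕜 (Fin n)) ∘ₗ
      (C.symm : EuclideanSpace 𝕜 (Fin n) →ₗ[𝕜] V)) = 1 := by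
    rw [← LinearMap.det_comp, ← LinearMap.det_id (M := EuclideanSpace 𝕜 (Fin n))]
    congr 1
    ext1 v; simp
  have h4 := congrArg norm h3
  rw [norm_mul, norm_one] at h4
  have h5 : ‖LinearMap.det ((C : V →ₗ[𝕜] EuclideanSpace 𝕜 (Fin n)) ∘ₗ
      (B.symm : EuclideanSpace 𝕜 (Fin n) →ₗ[𝕜] V))‖ = 1 := by
    refine le_antisymm h1 ?_
    nlinarith [norm_nonneg (LinearMap.det ((C : V →ₗ[𝕜] EuclideanSpace 𝕜 (Fin n)) ∘ₗ
      (B.symm : EuclideanSpace 𝕜 (Fin n) →ₗ[𝕜] V)))]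
  rw [h5, one_pow] at hdet
  have hpos : ∀ i, 0 < d i := fun i => (hd i).lt_of_ne' fun h0 => by
    rw [Finset.prod_eq_zero (Finset.mem_univ i) h0] at hdet
    exact one_ne_zero hdet
  have hlog : ∑ i, Real.log (d i) = 0 := by
    rw [← Real.log_prod fun i _ => (hpos i).ne', ← hdet, Real.log_one]
  -- Equality case of AM–GM: `∏ d i = 1` and `∑ d i ≤ n` force each nonnegative term `d i - 1 - log
  -- (d i)` to vanish.
  have hone : ∀ i, d i = 1 := by
    have hnn : ∀ i ∈ Finset.univ, 0 ≤ d i - 1 - Real.log (d i) := fun i _ => by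
      linarith [Real.log_le_sub_one_of_pos (hpos i)]
    have h0 : ∑ i, (d i - 1 - Real.log (d i)) = 0 := by
      refine le_antisymm ?_ (Finset.sum_nonneg hnn)
      rw [Finset.sum_sub_distrib, Finset.sum_sub_distrib, hlog]
      simpa using hsum
    intro i
    by_contra hi
    have := (Finset.sum_eq_zero_iff_of_nonneg hnn).1 h0 i (Finset.mem_univ i)
    linarith [Real.log_lt_sub_one_of_pos (hpos i) hi]
  have h6 : ‖C v‖ ^ 2 = ‖B v‖ ^ 2 := by
    have := hCd v
    rw [← b.repr.norm_map (B v), EuclideanSpace.norm_sq_eq (b.repr (B v))]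
    simpa [hone] using this
  exact (sq_eq_sq₀ (norm_nonneg _) (norm_nonneg _)).1 h6

end Extremal

/-! ### Existence of extremal maps and their dependence on the norm -/

section Stability

variable {𝕜 : Type w} [RCLike 𝕜] {n : ℕ}

theorem Seminorm.le_sum_mul_norm (p : Seminorm 𝕜 (EuclideanSpace 𝕜 (Fin n)))
    (v : EuclideanSpace 𝕜 (Fin n)) :
    p v ≤ (∑ i, p (EuclideanSpace.basisFun (Fin n) 𝕜 i)) * ‖v‖ := by
  conv_lhs => rw [← (EuclideanSpace.basisFun (Fin n) 𝕜).sum_repr v]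
  refine (Finset.le_sum_of_subadditive p (map_zero p).le (map_add_le_add p) _ _).trans ?_
  rw [Finset.sum_mul]
  refine Finset.sum_le_sum fun i _ => ?_
  rw [map_smul_eq_mul, mul_comm]
  exact mul_le_mul_of_nonneg_left (PiLp.norm_apply_le v i) (apply_nonneg _ _)

theorem Seminorm.sub_le_sum_mul_norm_sub (p : Seminorm 𝕜 (EuclideanSpace 𝕜 (Fin n)))
    (v w : EuclideanSpace 𝕜 (Fin n)) :
    p v - (∑ i, p (EuclideanSpace.basisFun (Fin n) 𝕜 i)) * ‖w - v‖ ≤ p w := by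
  have h1 : p v ≤ p (w - v) + p w := by
    rw [map_sub_rev]
    simpa using map_add_le_add p (v - w) w
  linarith [p.le_sum_mul_norm (w - v)]

theorem Seminorm.continuous_euclideanSpace (p : Seminorm 𝕜 (EuclideanSpace 𝕜 (Fin n))) :
    Continuous p := by
  refine continuous_iff_continuousAt.2 fun v => tendsto_of_tendsto_of_tendsto_of_le_of_le
    (g := fun w => p v - (∑ i, p (EuclideanSpace.basisFun (Fin n) 𝕜 i)) * ‖w - v‖)
    (h := fun w => p v + (∑ i, p (EuclideanSpace.basisFun (Fin n) 𝕜 i)) * ‖w - v‖) ?_ ?_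
    (fun w => p.sub_le_sum_mul_norm_sub v w) fun w => ?_
  · exact Continuous.tendsto' (by fun_prop) _ _ (by simp)
  · exact Continuous.tendsto' (by fun_prop) _ _ (by simp)
  · have := p.sub_le_sum_mul_norm_sub w v
    rw [norm_sub_rev] at this
    change p w ≤ _
    linarith

theorem Seminorm.exists_pos_mul_norm_le {p : Seminorm 𝕜 (EuclideanSpace 𝕜 (Fin n))}
    (hp : ∀ v, p v = 0 → v = 0) : ∃ c > 0, ∀ v, c * ‖v‖ ≤ p v := by
  rcases (Metric.sphere (0 : EuclideanSpace 𝕜 (Fin n)) 1).eq_empty_or_nonempty with h | h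
  · refine ⟨1, one_pos, fun v => ?_⟩
    rcases eq_or_ne v 0 with rfl | hv
    · simp
    · have : (((‖v‖⁻¹ : ℝ) : 𝕜) • v) ∈ Metric.sphere (0 : EuclideanSpace 𝕜 (Fin n)) 1 := by
        simp [norm_smul, inv_mul_cancel₀ (norm_ne_zero_iff.2 hv)]
      simp [h] at this
  · obtain ⟨u, hu, hmin⟩ := (isCompact_sphere (0 : EuclideanSpace 𝕜 (Fin n)) 1).exists_isMinOn h
      p.continuous_euclideanSpace.continuousOn
    refine ⟨p u, (apply_nonneg p u).lt_of_ne' fun h0 => ?_, fun v => ?_⟩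
    · rw [hp u h0] at hu
      simp at hu
    · rcases eq_or_ne v 0 with rfl | hv
      · simp
      have hmem : (((‖v‖⁻¹ : ℝ) : 𝕜) • v) ∈ Metric.sphere (0 : EuclideanSpace 𝕜 (Fin n)) 1 := by
        simp [norm_smul, inv_mul_cancel₀ (norm_ne_zero_iff.2 hv)]
      have h1 : p u ≤ p (((‖v‖⁻¹ : ℝ) : 𝕜) • v) := hmin hmem
      rw [map_smul_eq_mul] at h1
      simp only [RCLike.norm_ofReal, abs_inv, abs_norm] at h1
      rwa [← div_eq_inv_mul, le_div_iff₀ (norm_pos_iff.2 hv)] at h1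

/-- When the source is already `𝕜 ^ n`, determinants can be compared directly rather than relative
to `B`. This is the form that survives limits. -/
theorem isExtremal_iff_norm_det_le {p : Seminorm 𝕜 (EuclideanSpace 𝕜 (Fin n))}
    {B : EuclideanSpace 𝕜 (Fin n) ≃ₗ[𝕜] EuclideanSpace 𝕜 (Fin n)} :
    IsExtremal p B ↔ Dominated p (B : EuclideanSpace 𝕜 (Fin n) →ₗ[𝕜] EuclideanSpace 𝕜 (Fin n)) ∧
      ∀ C : EuclideanSpace 𝕜 (Fin n) →ₗ[𝕜] EuclideanSpace 𝕜 (Fin n), Dominated p C →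
        ‖LinearMap.det C‖ ≤ ‖LinearMap.det
          (B : EuclideanSpace 𝕜 (Fin n) →ₗ[𝕜] EuclideanSpace 𝕜 (Fin n))‖ := by
  have h1 : LinearMap.det (B.symm : EuclideanSpace 𝕜 (Fin n) →ₗ[𝕜] EuclideanSpace 𝕜 (Fin n)) *
      LinearMap.det (B : EuclideanSpace 𝕜 (Fin n) →ₗ[𝕜] EuclideanSpace 𝕜 (Fin n)) = 1 :=
    B.det_symm_mul_det
  have h2 : 0 < ‖LinearMap.det
      (B : EuclideanSpace 𝕜 (Fin n) →ₗ[𝕜] EuclideanSpace 𝕜 (Fin n))‖ :=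
    norm_pos_iff.2 (right_ne_zero_of_mul_eq_one h1)
  have key : ∀ C : EuclideanSpace 𝕜 (Fin n) →ₗ[𝕜] EuclideanSpace 𝕜 (Fin n),
      ‖LinearMap.det (C ∘ₗ
        (B.symm : EuclideanSpace 𝕜 (Fin n) →ₗ[𝕜] EuclideanSpace 𝕜 (Fin n)))‖ ≤ 1 ↔
      ‖LinearMap.det C‖ ≤ ‖LinearMap.det
          (B : EuclideanSpace 𝕜 (Fin n) →ₗ[𝕜] EuclideanSpace 𝕜 (Fin n))‖ := fun C => by
    rw [LinearMap.det_comp, eq_inv_of_mul_eq_one_left h1, ← div_eq_mul_inv, norm_div,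
      div_le_one h2]
  exact ⟨fun h => ⟨h.dominated, fun C hC => (key C).1 (h.norm_det_le_one C hC)⟩,
    fun h => ⟨h.1, fun C hC => (key C).2 (h.2 C hC)⟩⟩

/-- In coordinates the dominated maps form a closed bounded set of operators, on which `|det|`
attains its maximum. -/
theorem exists_isExtremal {V : Type v} [AddCommGroup V] [Module 𝕜 V] [Module.Finite 𝕜 V]
    (hn : Module.finrank 𝕜 V = n) (p : Seminorm 𝕜 V) (hp : ∀ v, p v = 0 → v = 0) :
    ∃ B : V ≃ₗ[𝕜] EuclideanSpace 𝕜 (Fin n), IsExtremal p B := by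
  let φ : V ≃ₗ[𝕜] EuclideanSpace 𝕜 (Fin n) :=
    LinearEquiv.ofFinrankEq _ _ (hn.trans finrank_euclideanSpace_fin.symm)
  let q : Seminorm 𝕜 (EuclideanSpace 𝕜 (Fin n)) :=
    p.comp (φ.symm : EuclideanSpace 𝕜 (Fin n) →ₗ[𝕜] V)
  have hq : ∀ v, q v = 0 → v = 0 := fun v hv => φ.symm.map_eq_zero_iff.1 (hp _ hv)
  suffices h : ∃ B, IsExtremal q B by
    obtain ⟨B, hB⟩ := h
    refine ⟨φ.trans B, ?_⟩
    convert hB.comp φ using 1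
    ext v
    simp [q]
  let S : Set (EuclideanSpace 𝕜 (Fin n) →L[𝕜] EuclideanSpace 𝕜 (Fin n)) :=
    {B | ∀ v, ‖B v‖ ≤ q v}
  have hSc : IsCompact S := by
    have := FiniteDimensional.proper 𝕜 (EuclideanSpace 𝕜 (Fin n) →L[𝕜] EuclideanSpace 𝕜 (Fin n))
    refine Metric.isCompact_of_isClosed_isBounded ?_ ?_
    · simp only [S, Set.ofPred_forall]
      exact isClosed_iInter fun v => isClosed_le (by fun_prop) continuous_const
    · refine (Metric.isBounded_closedBall (x := 0)
        (r := ∑ i, q (EuclideanSpace.basisFun (Fin n) 𝕜 i))).subset fun B hB => ?_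
      rw [mem_closedBall_zero_iff]
      exact B.opNorm_le_bound (Finset.sum_nonneg fun i _ => apply_nonneg _ _)
        fun v => (hB v).trans (q.le_sum_mul_norm v)
  obtain ⟨B, hBS, hmax⟩ := hSc.exists_isMaxOn ⟨0, fun v => by simp⟩
    (ContinuousLinearMap.continuous_det.norm.continuousOn)
  obtain ⟨c, hc, hcq⟩ := Seminorm.exists_pos_mul_norm_le hq
  have hdet : LinearMap.det (B : EuclideanSpace 𝕜 (Fin n) →ₗ[𝕜] EuclideanSpace 𝕜 (Fin n)) ≠ 0 := by
    -- The scalar map `c • id` is dominated, so the maximum is at least `c ^ n > 0` and the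
    -- maximizer is invertible.
    have h1 : ‖((c : 𝕜) • ContinuousLinearMap.id 𝕜 (EuclideanSpace 𝕜 (Fin n))).det‖ ≤ ‖B.det‖ :=
      hmax fun v => by simpa [norm_smul, abs_of_pos hc] using hcq v
    have h2 : ((c : 𝕜) • ContinuousLinearMap.id 𝕜 (EuclideanSpace 𝕜 (Fin n))).det = (c : 𝕜) ^ n := by
      change LinearMap.det ((c : 𝕜) • (LinearMap.id :
        EuclideanSpace 𝕜 (Fin n) →ₗ[𝕜] EuclideanSpace 𝕜 (Fin n))) = _
      rw [LinearMap.det_smul, LinearMap.det_id, finrank_euclideanSpace_fin, mul_one]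
    rw [h2, norm_pow, RCLike.norm_ofReal, abs_of_pos hc] at h1
    exact norm_pos_iff.1 ((pow_pos hc n).trans_le h1)
  refine ⟨LinearMap.equivOfDetNeZero _ hdet, isExtremal_iff_norm_det_le.2 ⟨hBS, fun C hC => ?_⟩⟩
  exact hmax (a := LinearMap.toContinuousLinearMap C) hC

/-- Pointwise convergence of seminorms to a norm is uniform on the unit sphere. -/
theorem eventually_mul_le_of_tendsto {ι : Type*} {l : Filter ι}
    {p : Seminorm 𝕜 (EuclideanSpace 𝕜 (Fin n))} {q : ι → Seminorm 𝕜 (EuclideanSpace 𝕜 (Fin n))}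
    (hp : ∀ v, p v = 0 → v = 0) (hq : ∀ v, Tendsto (fun t => q t v) l (𝓝 (p v)))
    {ε : ℝ} (hε : 0 < ε) : ∀ᶠ t in l, ∀ v, (1 - ε) * p v ≤ q t v := by
  obtain ⟨c, hc, hcp⟩ := Seminorm.exists_pos_mul_norm_le hp
  have hS : Tendsto (fun t => ∑ i, q t (EuclideanSpace.basisFun (Fin n) 𝕜 i)) l
      (𝓝 (∑ i, p (EuclideanSpace.basisFun (Fin n) 𝕜 i))) :=
    tendsto_finsetSum _ fun i _ => hq _
  -- The Lipschitz constants `∑ q t (e i)` converge, so closeness at one point of the sphere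
  -- persists nearby, and compactness makes it uniform. The absolute error `ε * c` becomes the
  -- relative error `ε` because `c * ‖v‖ ≤ p v`.
  have hK := (isCompact_sphere (0 : EuclideanSpace 𝕜 (Fin n)) 1).mem_prod_nhdsSet_of_forall
    (l := l) (s := {x : ι × EuclideanSpace 𝕜 (Fin n) | p x.2 - q x.1 x.2 < ε * c}) fun v _ => by
      have h1 : Tendsto (fun x : ι × EuclideanSpace 𝕜 (Fin n) => p x.2 - (q x.1 v -
          (∑ i, q x.1 (EuclideanSpace.basisFun (Fin n) 𝕜 i)) * ‖x.2 - v‖)) (l ×ˢ 𝓝 v)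
          (𝓝 (p v - (p v - (∑ i, p (EuclideanSpace.basisFun (Fin n) 𝕜 i)) * ‖v - v‖))) := by
        have hs : Tendsto (fun x : ι × EuclideanSpace 𝕜 (Fin n) => x.2) (l ×ˢ 𝓝 v) (𝓝 v) :=
          tendsto_snd
        exact ((p.continuous_euclideanSpace.tendsto v).comp hs).sub
          (((hq v).comp tendsto_fst).sub
            ((hS.comp tendsto_fst).mul (hs.sub tendsto_const_nhds).norm))
      have h2 := h1.eventually (gt_mem_nhds (by simpa using mul_pos hε hc : _ < ε * c))
      filter_upwards [h2] with x hx
      have := (q x.1).sub_le_sum_mul_norm_sub v x.2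
      change p x.2 - q x.1 x.2 < ε * c
      linarith
  obtain ⟨s, hs, U, hU, hsU⟩ := mem_prod_iff.1 hK
  filter_upwards [hs] with t ht v
  rcases eq_or_ne v 0 with rfl | hv
  · simp
  have hmem : (((‖v‖⁻¹ : ℝ) : 𝕜) • v) ∈ Metric.sphere (0 : EuclideanSpace 𝕜 (Fin n)) 1 := by
    simp [norm_smul, inv_mul_cancel₀ (norm_ne_zero_iff.2 hv)]
  have h1 : p (((‖v‖⁻¹ : ℝ) : 𝕜) • v) - q t (((‖v‖⁻¹ : ℝ) : 𝕜) • v) < ε * c :=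
    hsU (Set.mk_mem_prod ht (subset_of_mem_nhdsSet hU hmem))
  simp only [map_smul_eq_mul, RCLike.norm_ofReal, abs_inv, abs_norm] at h1
  rw [← mul_sub, ← div_eq_inv_mul, div_lt_iff₀ (norm_pos_iff.2 hv)] at h1
  nlinarith [hcp v]

/-- The Euclidean norm attached to an extremal map depends continuously on the norm. -/
theorem tendsto_norm_of_isExtremal {ι : Type*} {l : Filter ι}
    {p : Seminorm 𝕜 (EuclideanSpace 𝕜 (Fin n))} {q : ι → Seminorm 𝕜 (EuclideanSpace 𝕜 (Fin n))}
    (hp : ∀ v, p v = 0 → v = 0) (hq : ∀ v, Tendsto (fun t => q t v) l (𝓝 (p v)))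
    {B : EuclideanSpace 𝕜 (Fin n) ≃ₗ[𝕜] EuclideanSpace 𝕜 (Fin n)} (hB : IsExtremal p B)
    {A : ι → EuclideanSpace 𝕜 (Fin n) →ₗ[𝕜] EuclideanSpace 𝕜 (Fin n)}
    (hA : ∀ᶠ t in l, ∃ e : EuclideanSpace 𝕜 (Fin n) ≃ₗ[𝕜] EuclideanSpace 𝕜 (Fin n),
      IsExtremal (q t) e ∧ (e : EuclideanSpace 𝕜 (Fin n) →ₗ[𝕜] EuclideanSpace 𝕜 (Fin n)) = A t)
    (v : EuclideanSpace 𝕜 (Fin n)) : Tendsto (fun t => ‖A t v‖) l (𝓝 ‖B v‖) := by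
  -- Along an ultrafilter the maps `A t`, eventually bounded in operator norm, converge to some `T`.
  -- It suffices that `T` is extremal for `p`, since then `‖T v‖ = ‖B v‖` by uniqueness.
  rw [tendsto_iff_ultrafilter]
  intro g hg
  have hA' : ∀ᶠ t in l, Dominated (q t) (A t) ∧
      ∀ C : EuclideanSpace 𝕜 (Fin n) →ₗ[𝕜] EuclideanSpace 𝕜 (Fin n), Dominated (q t) C →
        ‖LinearMap.det C‖ ≤ ‖LinearMap.det (A t)‖ := by
    filter_upwards [hA] with t ⟨e, he, h⟩
    rw [isExtremal_iff_norm_det_le, h] at he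
    exact he
  have hS : Tendsto (fun t => ∑ i, q t (EuclideanSpace.basisFun (Fin n) 𝕜 i)) l
      (𝓝 (∑ i, p (EuclideanSpace.basisFun (Fin n) 𝕜 i))) :=
    tendsto_finsetSum _ fun i _ => hq _
  have := FiniteDimensional.proper 𝕜 (EuclideanSpace 𝕜 (Fin n) →L[𝕜] EuclideanSpace 𝕜 (Fin n))
  let F : ι → EuclideanSpace 𝕜 (Fin n) →L[𝕜] EuclideanSpace 𝕜 (Fin n) :=
    fun t => LinearMap.toContinuousLinearMap (A t)
  obtain ⟨T, -, hT⟩ := (isCompact_closedBall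
    (0 : EuclideanSpace 𝕜 (Fin n) →L[𝕜] EuclideanSpace 𝕜 (Fin n))
    (∑ i, p (EuclideanSpace.basisFun (Fin n) 𝕜 i) + 1)).ultrafilter_le_nhds (g.map F) (by
      rw [le_principal_iff, Ultrafilter.coe_map]
      refine hg ?_
      filter_upwards [hA', hS.eventually (gt_mem_nhds (lt_add_one _))] with t ht hSt
      rw [Set.mem_preimage, mem_closedBall_zero_iff]
      refine (F t).opNorm_le_bound (by
        refine add_nonneg (Finset.sum_nonneg fun i _ => apply_nonneg _ _) zero_le_one)
        fun w => (ht.1 w).trans (((q t).le_sum_mul_norm w).trans ?_)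
      exact mul_le_mul_of_nonneg_right hSt.le (norm_nonneg w))
  have hT' : Tendsto F g (𝓝 T) := hT
  have heval : ∀ w, Tendsto (fun t => ‖A t w‖) g (𝓝 ‖T w‖) := fun w =>
    (((ContinuousLinearMap.apply 𝕜 (EuclideanSpace 𝕜 (Fin n)) w).continuous.tendsto T).comp
      hT').norm
  have hdom : Dominated p (T : EuclideanSpace 𝕜 (Fin n) →ₗ[𝕜] EuclideanSpace 𝕜 (Fin n)) :=
    fun w => le_of_tendsto_of_tendsto (heval w) ((hq w).mono_left hg)
      (by filter_upwards [hg hA'] with t ht using ht.1 w)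
  have hdetT : Tendsto (fun t => ‖LinearMap.det (A t)‖) g (𝓝 ‖T.det‖) :=
    ((ContinuousLinearMap.continuous_det.tendsto T).comp hT').norm
  rw [isExtremal_iff_norm_det_le] at hB
  -- For small `ε` the map `(1 - ε) B` is eventually dominated by `q t`, so it competes with `A t`.
  -- Passing to the limit in `t` and then in `ε` shows that `T` does at least as well as `B`.
  have hdet : ‖LinearMap.det (B : EuclideanSpace 𝕜 (Fin n) →ₗ[𝕜] EuclideanSpace 𝕜 (Fin n))‖ ≤
      ‖T.det‖ := by
    have h1 : ∀ ε : ℝ, 0 < ε → ε < 1 → (1 - ε) ^ n *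
        ‖LinearMap.det (B : EuclideanSpace 𝕜 (Fin n) →ₗ[𝕜] EuclideanSpace 𝕜 (Fin n))‖ ≤
        ‖T.det‖ := fun ε h0 h1 => by
      refine ge_of_tendsto hdetT ?_
      filter_upwards [hg hA', hg (eventually_mul_le_of_tendsto hp hq h0)] with t ht hle
      have h2 := ht.2 (((1 - ε : ℝ) : 𝕜) •
        (B : EuclideanSpace 𝕜 (Fin n) →ₗ[𝕜] EuclideanSpace 𝕜 (Fin n))) fun w => by
          rw [LinearMap.smul_apply, norm_smul, RCLike.norm_ofReal, abs_of_pos (by linarith)]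
          exact (mul_le_mul_of_nonneg_left (hB.1 w) (by linarith)).trans (hle w)
      rwa [LinearMap.det_smul, finrank_euclideanSpace_fin, norm_mul, norm_pow,
        RCLike.norm_ofReal, abs_of_pos (by linarith)] at h2
    have h2 : Tendsto (fun ε : ℝ => (1 - ε) ^ n *
        ‖LinearMap.det (B : EuclideanSpace 𝕜 (Fin n) →ₗ[𝕜] EuclideanSpace 𝕜 (Fin n))‖) (𝓝[>] 0)
        (𝓝 ‖LinearMap.det
          (B : EuclideanSpace 𝕜 (Fin n) →ₗ[𝕜] EuclideanSpace 𝕜 (Fin n))‖) :=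
      (Continuous.tendsto' (by fun_prop) _ _ (by simp)).mono_left nhdsWithin_le_nhds
    refine le_of_tendsto h2 ?_
    filter_upwards [Ioo_mem_nhdsGT (zero_lt_one' ℝ)] with ε hε using h1 ε hε.1 hε.2
  have hB0 : LinearMap.det
      (B : EuclideanSpace 𝕜 (Fin n) →ₗ[𝕜] EuclideanSpace 𝕜 (Fin n)) ≠ 0 :=
    left_ne_zero_of_mul_eq_one B.det_mul_det_symm
  have hT0 : LinearMap.det
      (T : EuclideanSpace 𝕜 (Fin n) →ₗ[𝕜] EuclideanSpace 𝕜 (Fin n)) ≠ 0 :=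
    norm_pos_iff.1 ((norm_pos_iff.2 hB0).trans_le hdet)
  have hTe : IsExtremal p (LinearMap.equivOfDetNeZero _ hT0) :=
    isExtremal_iff_norm_det_le.2 ⟨hdom, fun C hC => (hB.2 C hC).trans hdet⟩
  rw [hTe.norm_eq (isExtremal_iff_norm_det_le.2 hB) v]
  exact heval v

end Stability

/-! ### Volumes and centres of ellipsoids -/

section Volume

variable {𝕜 : Type w} [RCLike 𝕜]

/-- Multiplication by `z ≠ 0` is `‖z‖` times a real-linear isometry, whose determinant has absolute
value `1`. -/
theorem RCLike.abs_algebraNorm_real (z : 𝕜) :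
    |Algebra.norm ℝ z| = ‖z‖ ^ Module.finrank ℝ 𝕜 := by
  rcases eq_or_ne z 0 with rfl | hz
  · simp [Module.finrank_pos.ne']
  let u : 𝕜 →ₗᵢ[ℝ] 𝕜 :=
    { toLinearMap := (‖z‖⁻¹ : ℝ) • Algebra.lmul ℝ 𝕜 z
      norm_map' := fun a => by
        simp [norm_smul, ← mul_assoc, inv_mul_cancel₀ (norm_ne_zero_iff.2 hz)] }
  have hu : Algebra.lmul ℝ 𝕜 z = ‖z‖ • u.toLinearMap := by
    ext a
    simp [u, smul_smul, mul_inv_cancel₀ (norm_ne_zero_iff.2 hz)]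
  have h1 := u.normDet_eq_one
  rw [LinearMap.normDet_eq_norm_det, Real.norm_eq_abs] at h1
  rw [Algebra.norm_apply, hu, LinearMap.det_smul, abs_mul, h1, mul_one, abs_pow, abs_norm]

/-- Haar measure scales by the real determinant, whereas extremality is about the `𝕜`-linear one.
They differ by the exponent `[𝕜 : ℝ]`, so both order ellipsoids alike. -/
theorem abs_det_restrictScalars_real {W : Type*} [AddCommGroup W] [Module 𝕜 W] [Module ℝ W]
    [IsScalarTower ℝ 𝕜 W] (g : W →ₗ[𝕜] W) :
    |LinearMap.det (g.restrictScalars ℝ)| = ‖LinearMap.det g‖ ^ Module.finrank ℝ 𝕜 := by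
  rw [LinearMap.det_restrictScalars, RCLike.abs_algebraNorm_real]

variable {V : Type v} [AddCommGroup V] [Module 𝕜 V] {n : ℕ}

theorem addHaar_image_ellipsoid (f : EuclideanSpace 𝕜 (Fin n) ≃ᵃ[𝕜] V)
    (φ : V ≃ₗ[𝕜] EuclideanSpace 𝕜 (Fin n)) :
    MeasureTheory.Measure.addHaar (φ '' (f '' Metric.closedBall 0 1)) =
      ENNReal.ofReal (‖LinearMap.det ((φ : V →ₗ[𝕜] EuclideanSpace 𝕜 (Fin n)) ∘ₗ
        (f.linear : EuclideanSpace 𝕜 (Fin n) →ₗ[𝕜] V))‖ ^ Module.finrank ℝ 𝕜) *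
      MeasureTheory.Measure.addHaar (Metric.closedBall (0 : EuclideanSpace 𝕜 (Fin n)) 1) := by
  let g : EuclideanSpace 𝕜 (Fin n) →ₗ[𝕜] EuclideanSpace 𝕜 (Fin n) :=
    (φ : V →ₗ[𝕜] EuclideanSpace 𝕜 (Fin n)) ∘ₗ (f.linear : EuclideanSpace 𝕜 (Fin n) →ₗ[𝕜] V)
  have h : φ '' (f '' Metric.closedBall 0 1) =
      (fun z => z + φ (f 0)) '' (g.restrictScalars ℝ '' Metric.closedBall 0 1) := by
    rw [Set.image_image, Set.image_image]
    refine Set.image_congr fun z _ => ?_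
    have h1 : f z = f.linear z + f 0 := by
      have := f.map_vadd 0 z
      simpa using this
    rw [h1, map_add]
    rfl
  rw [h, Set.image_add_right, MeasureTheory.measure_preimage_add_right,
    MeasureTheory.Measure.addHaar_image_linearMap, abs_det_restrictScalars_real]

theorem ellipsoid_eq (f : EuclideanSpace 𝕜 (Fin n) ≃ᵃ[𝕜] V) :
    f '' Metric.closedBall 0 1 = {v | ‖f.linear.symm (v - f 0)‖ ≤ 1} := by
  have h1 : ∀ z, f z = f.linear z + f 0 := fun z => by
    have := f.map_vadd 0 z
    simpa using this
  ext v
  constructor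
  · rintro ⟨z, hz, rfl⟩
    simpa [h1 z] using hz
  · intro hv
    refine ⟨f.linear.symm (v - f 0), by simpa using hv, ?_⟩
    rw [h1]
    simp

/-- An ellipsoid containing the unit ball of a norm stays an upper bound after it is centred at the
origin and shrunk accordingly. -/
theorem norm_sq_le_of_unitBall_subset {p : Seminorm 𝕜 V} (hp : ∀ v, p v = 0 → v = 0)
    {a : V ≃ₗ[𝕜] EuclideanSpace 𝕜 (Fin n)} {c : V}
    (h : {v | p v ≤ 1} ⊆ {v | ‖a (v - c)‖ ≤ 1}) :
    ‖a c‖ < 1 ∧ ∀ v, ‖a v‖ ^ 2 ≤ (1 - ‖a c‖ ^ 2) * p v ^ 2 := by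
  -- The unit ball is symmetric: the containment is applied to `v` and `-v`, and the parallelogram
  -- law adds the two estimates.
  have h1 : ∀ v, p v ≤ 1 → ‖a v‖ ^ 2 + ‖a c‖ ^ 2 ≤ 1 := fun v hv => by
    have h2 : ‖a (v - c)‖ ≤ 1 := h hv
    have h3 : ‖a (-v - c)‖ ≤ 1 := h (by simpa using hv : p (-v) ≤ 1)
    rw [← neg_add', map_neg, norm_neg, map_add] at h3
    rw [map_sub] at h2
    have h4 := parallelogram_law_with_norm 𝕜 (a v) (a c)
    nlinarith [norm_nonneg (a v - a c), norm_nonneg (a v + a c)]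
  have h2 : ∀ v, ‖a v‖ ^ 2 ≤ (1 - ‖a c‖ ^ 2) * p v ^ 2 := fun v => by
    rcases eq_or_ne v 0 with rfl | hv
    · simp
    have hpv : 0 < p v := (apply_nonneg p v).lt_of_ne' fun h0 => hv (hp v h0)
    have h3 := h1 ((((p v)⁻¹ : ℝ) : 𝕜) • v) (by
      rw [map_smul_eq_mul, RCLike.norm_ofReal, abs_of_pos (inv_pos.2 hpv),
        inv_mul_cancel₀ hpv.ne'])
    rw [map_smul, norm_smul, RCLike.norm_ofReal, abs_of_pos (inv_pos.2 hpv), mul_pow, inv_pow,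
      ← div_eq_inv_mul] at h3
    have h4 : ‖a v‖ ^ 2 / p v ^ 2 ≤ 1 - ‖a c‖ ^ 2 := by linarith
    exact (div_le_iff₀ (by positivity)).1 h4
  refine ⟨?_, h2⟩
  -- If `‖a c‖ ≥ 1`, the bound `h2` at the centre `c` itself would give `‖a c‖² ≤ 0`.
  by_contra hc
  have hc' : 1 ≤ ‖a c‖ := not_lt.1 hc
  have h3 := h2 c
  have h4 : (1 - ‖a c‖ ^ 2) * p c ^ 2 ≤ 0 :=
    mul_nonpos_of_nonpos_of_nonneg (by nlinarith) (sq_nonneg _)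
  nlinarith

end Volume

/-! ### Extremal maps and Löwner ellipsoids -/

section Lowner

variable {𝕜 : Type w} [RCLike 𝕜] {V : Type v} [AddCommGroup V] [Module 𝕜 V] {n : ℕ}

/-- Dividing `a` by `√(1 - ‖a c‖ ^ 2)` leaves a dominated map, which `B` beats. The factor measures
the volume wasted by an off-centre ellipsoid. -/
theorem IsExtremal.norm_det_le_of_unitBall_subset {p : Seminorm 𝕜 V} (hp : ∀ v, p v = 0 → v = 0)
    {B : V ≃ₗ[𝕜] EuclideanSpace 𝕜 (Fin n)} (hB : IsExtremal p B)
    {a : V ≃ₗ[𝕜] EuclideanSpace 𝕜 (Fin n)} {c : V}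
    (h : {v | p v ≤ 1} ⊆ {v | ‖a (v - c)‖ ≤ 1}) :
    ‖LinearMap.det ((a : V →ₗ[𝕜] EuclideanSpace 𝕜 (Fin n)) ∘ₗ
      (B.symm : EuclideanSpace 𝕜 (Fin n) →ₗ[𝕜] V))‖ ≤ √(1 - ‖a c‖ ^ 2) ^ n := by
  obtain ⟨hc, ha⟩ := norm_sq_le_of_unitBall_subset hp h
  have hr : 0 < √(1 - ‖a c‖ ^ 2) := Real.sqrt_pos.2 (by nlinarith [norm_nonneg (a c)])
  have h1 := hB.norm_det_le_one ((((√(1 - ‖a c‖ ^ 2))⁻¹ : ℝ) : 𝕜) •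
    (a : V →ₗ[𝕜] EuclideanSpace 𝕜 (Fin n))) fun v => by
      rw [LinearMap.smul_apply, norm_smul, RCLike.norm_ofReal, abs_of_pos (inv_pos.2 hr),
        ← div_eq_inv_mul, div_le_iff₀ hr]
      refine abs_le_of_sq_le_sq' ?_ (mul_nonneg (apply_nonneg p v) hr.le) |>.2
      rw [mul_pow, Real.sq_sqrt (Real.sqrt_pos.1 hr).le, mul_comm]
      exact ha v
  rwa [LinearMap.smul_comp, LinearMap.det_smul, finrank_euclideanSpace_fin, norm_mul, norm_pow,
    RCLike.norm_ofReal, abs_of_pos (inv_pos.2 hr), inv_pow, ← div_eq_inv_mul,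
    div_le_one (pow_pos hr n)] at h1

theorem LinearEquiv.image_closedBall_eq (B : V ≃ₗ[𝕜] EuclideanSpace 𝕜 (Fin n)) :
    B.symm.toAffineEquiv '' Metric.closedBall 0 1 = {v | ‖B v‖ ≤ 1} := by
  rw [ellipsoid_eq]
  ext v
  change ‖B (v - B.symm 0)‖ ≤ 1 ↔ ‖B v‖ ≤ 1
  rw [map_zero, sub_zero]

theorem det_comp_symm_eq (φ B : V ≃ₗ[𝕜] EuclideanSpace 𝕜 (Fin n))
    (a : EuclideanSpace 𝕜 (Fin n) ≃ₗ[𝕜] V) :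
    LinearMap.det ((φ : V →ₗ[𝕜] EuclideanSpace 𝕜 (Fin n)) ∘ₗ
        (B.symm : EuclideanSpace 𝕜 (Fin n) →ₗ[𝕜] V)) =
      LinearMap.det ((φ : V →ₗ[𝕜] EuclideanSpace 𝕜 (Fin n)) ∘ₗ
        (a : EuclideanSpace 𝕜 (Fin n) →ₗ[𝕜] V)) *
      LinearMap.det ((a.symm : V →ₗ[𝕜] EuclideanSpace 𝕜 (Fin n)) ∘ₗ
        (B.symm : EuclideanSpace 𝕜 (Fin n) →ₗ[𝕜] V)) := by
  rw [← LinearMap.det_comp]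
  congr 1
  ext1 v
  simp

/-- With `a` the inverse of the linear part of a competitor, `|det (a B⁻¹)| ≤ 1`. Multiplicativity
of the determinant turns this into the volume inequality in any coordinates `φ`. -/
theorem IsExtremal.isLownerEllipsoid {p : Seminorm 𝕜 V} (hp : ∀ v, p v = 0 → v = 0)
    (hn : Module.finrank 𝕜 V = n)
    {B : V ≃ₗ[𝕜] EuclideanSpace 𝕜 (Fin n)} (hB : IsExtremal p B) :
    IsLownerEllipsoid 𝕜 {v | p v ≤ 1} {v | ‖B v‖ ≤ 1} := by
  subst hn
  refine ⟨⟨B.symm.toAffineEquiv, B.image_closedBall_eq.symm⟩,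
    fun v hv => (hB.dominated v).trans hv, ?_⟩
  rintro _ ⟨f, rfl⟩ hf φ
  rw [← B.image_closedBall_eq, addHaar_image_ellipsoid, addHaar_image_ellipsoid]
  rw [ellipsoid_eq] at hf
  have h1 := hB.norm_det_le_of_unitBall_subset hp hf
  gcongr
  change ‖LinearMap.det ((φ : V →ₗ[𝕜] EuclideanSpace 𝕜 (Fin (Module.finrank 𝕜 V))) ∘ₗ
    (B.symm : EuclideanSpace 𝕜 (Fin (Module.finrank 𝕜 V)) →ₗ[𝕜] V))‖ ≤ _
  rw [det_comp_symm_eq φ B f.linear, norm_mul]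
  refine mul_le_of_le_one_right (norm_nonneg _) (h1.trans (pow_le_one₀ (Real.sqrt_nonneg _) ?_))
  rw [Real.sqrt_le_one]
  linarith [sq_nonneg ‖f.linear.symm (f 0)‖]

/-- Minimality, read in the coordinates `B`, gives `|det (a B⁻¹)| ≥ 1`. Against the off-centre bound
this forces the centre to be `0` and makes `a` extremal, so uniqueness up to isometry applies. -/
theorem IsExtremal.eq_of_isLownerEllipsoid {p : Seminorm 𝕜 V} (hp : ∀ v, p v = 0 → v = 0)
    (hn : Module.finrank 𝕜 V = n)
    {B : V ≃ₗ[𝕜] EuclideanSpace 𝕜 (Fin n)} (hB : IsExtremal p B) {L : Set V}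
    (hL : IsLownerEllipsoid 𝕜 {v | p v ≤ 1} L) : L = {v | ‖B v‖ ≤ 1} := by
  have hLB := hB.isLownerEllipsoid hp hn
  subst hn
  obtain ⟨⟨f, rfl⟩, hf, hmin⟩ := hL
  have hvol := hmin _ hLB.1 hLB.2.1 B
  rw [← B.image_closedBall_eq, addHaar_image_ellipsoid, addHaar_image_ellipsoid] at hvol
  rw [ellipsoid_eq] at hf ⊢
  set a := f.linear.symm with ha
  set c := f 0
  have hdet1 : LinearMap.det ((B : V →ₗ[𝕜] EuclideanSpace 𝕜 (Fin (Module.finrank 𝕜 V))) ∘ₗ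
      (B.symm : EuclideanSpace 𝕜 (Fin (Module.finrank 𝕜 V)) →ₗ[𝕜] V)) = 1 := by
    rw [← LinearMap.det_id (M := EuclideanSpace 𝕜 (Fin (Module.finrank 𝕜 V)))]
    congr 1
    ext1 v
    simp
  have hBf : ‖LinearMap.det ((B : V →ₗ[𝕜] EuclideanSpace 𝕜 (Fin (Module.finrank 𝕜 V))) ∘ₗ
      (f.linear : EuclideanSpace 𝕜 (Fin (Module.finrank 𝕜 V)) →ₗ[𝕜] V))‖ ≤ 1 := by
    have h1 := (ENNReal.mul_le_mul_iff_left (Metric.measure_closedBall_pos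
      MeasureTheory.Measure.addHaar _ one_pos).ne'
      MeasureTheory.measure_closedBall_lt_top.ne).1 hvol
    change _ ≤ ENNReal.ofReal (‖LinearMap.det
      ((B : V →ₗ[𝕜] EuclideanSpace 𝕜 (Fin (Module.finrank 𝕜 V))) ∘ₗ
      (B.symm : EuclideanSpace 𝕜 (Fin (Module.finrank 𝕜 V)) →ₗ[𝕜] V))‖ ^ _) at h1
    rw [hdet1, norm_one, one_pow, ENNReal.ofReal_one, ENNReal.ofReal_le_one] at h1
    exact (pow_le_one_iff_of_nonneg (norm_nonneg _) Module.finrank_pos.ne').1 h1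
  have h2 := det_comp_symm_eq B B f.linear
  rw [hdet1] at h2
  have h3 := congrArg norm h2
  rw [norm_one, norm_mul] at h3
  have h4 := hB.norm_det_le_of_unitBall_subset hp hf
  have h5 : 1 ≤ √(1 - ‖a c‖ ^ 2) ^ Module.finrank 𝕜 V := by
    refine le_trans ?_ h4
    rw [h3]
    exact mul_le_of_le_one_left (norm_nonneg _) hBf
  -- In dimension `0` the exponent carries no information, but the space is trivial.
  have hc : c = 0 := by
    rcases Nat.eq_zero_or_pos (Module.finrank 𝕜 V) with h0 | h0
    · have : IsEmpty (Fin (Module.finrank 𝕜 V)) := by rw [h0]; infer_instance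
      exact a.injective (Subsingleton.elim _ _)
    · have h6 := (one_le_pow_iff_of_nonneg (Real.sqrt_nonneg _) h0.ne').1 h5
      rw [Real.one_le_sqrt] at h6
      have h7 : ‖a c‖ = 0 := by nlinarith [norm_nonneg (a c)]
      exact a.map_eq_zero_iff.1 (norm_eq_zero.1 h7)
  have haE : IsExtremal p a := by
    refine ⟨fun v => ?_, fun C hC => ?_⟩
    · refine abs_le_of_sq_le_sq' ?_ (apply_nonneg p v) |>.2
      have := (norm_sq_le_of_unitBall_subset hp hf).2 v
      simpa [hc] using this
    · have h8 : C ∘ₗ (a.symm : EuclideanSpace 𝕜 (Fin (Module.finrank 𝕜 V)) →ₗ[𝕜] V) =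
          (C ∘ₗ (B.symm : EuclideanSpace 𝕜 (Fin (Module.finrank 𝕜 V)) →ₗ[𝕜] V)) ∘ₗ
          ((B : V →ₗ[𝕜] EuclideanSpace 𝕜 (Fin (Module.finrank 𝕜 V))) ∘ₗ
          (f.linear : EuclideanSpace 𝕜 (Fin (Module.finrank 𝕜 V)) →ₗ[𝕜] V)) := by
        ext1 v
        simp [ha]
      rw [h8, LinearMap.det_comp, norm_mul]
      exact mul_le_one₀ (hB.norm_det_le_one C hC) (norm_nonneg _) hBf
  ext v
  simp only [Set.mem_ofPred_eq]
  rw [hc, sub_zero, hB.norm_eq haE v]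

end Lowner

/-! ### Continuity of the Löwner norm on the total space -/

section LownerNorm

variable {𝕜 : Type w} [RCLike 𝕜] {X : Type u} [TopologicalSpace X]
  {E : LinearBundle.{w, u, v} 𝕜 X} {n : ℕ}

namespace LinearBundle

section Limits

variable {ι : Type*} {l : Filter ι} {y : ι → X} {x : X}

theorem tendsto_add {s t : ∀ i, E.Fiber (y i)} {a b : E.Fiber x}
    (hs : Tendsto (fun i => (⟨y i, s i⟩ : E.Total)) l (𝓝 ⟨x, a⟩))
    (ht : Tendsto (fun i => (⟨y i, t i⟩ : E.Total)) l (𝓝 ⟨x, b⟩)) :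
    Tendsto (fun i => (⟨y i, s i + t i⟩ : E.Total)) l (𝓝 ⟨x, a + b⟩) := by
  have h : Tendsto (fun i => (⟨y i, (s i, t i)⟩ : TotalSpace (Unit × Unit) (E.Fiber ×ᵇ E.Fiber))) l
      (𝓝 ⟨x, (a, b)⟩) :=
    (FiberBundle.Prod.isInducing_diag Unit E.Fiber Unit E.Fiber).tendsto_nhds_iff.2
      (hs.prodMk_nhds ht)
  exact (E.continuous_add.tendsto _).comp h

theorem tendsto_const_smul (c : 𝕜) {s : ∀ i, E.Fiber (y i)} {a : E.Fiber x}
    (hs : Tendsto (fun i => (⟨y i, s i⟩ : E.Total)) l (𝓝 ⟨x, a⟩)) :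
    Tendsto (fun i => (⟨y i, c • s i⟩ : E.Total)) l (𝓝 ⟨x, c • a⟩) :=
  (E.continuous_smul.tendsto (c, ⟨x, a⟩)).comp (tendsto_const_nhds.prodMk_nhds hs)

theorem tendsto_sum {κ : Type*} (S : Finset κ) {s : ∀ i, κ → E.Fiber (y i)} {a : κ → E.Fiber x}
    (hy : Tendsto y l (𝓝 x))
    (hs : ∀ k ∈ S, Tendsto (fun i => (⟨y i, s i k⟩ : E.Total)) l (𝓝 ⟨x, a k⟩)) :
    Tendsto (fun i => (⟨y i, ∑ k ∈ S, s i k⟩ : E.Total)) l (𝓝 ⟨x, ∑ k ∈ S, a k⟩) := by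
  classical
  induction S using Finset.induction_on with
  | empty =>
    simp only [Finset.sum_empty]
    exact (E.continuous_zero_section.tendsto x).comp hy
  | insert k S hk ih =>
    simp only [Finset.sum_insert hk]
    exact tendsto_add (hs k (Finset.mem_insert_self k S))
      (ih fun j hj => hs j (Finset.mem_insert_of_mem hj))

end Limits

/-- Near `⟨x, v⟩` every point of the total space can be completed by vectors in the same fibre which
are close to prescribed vectors in the fibre over `x`. -/
theorem eventually_nhds_of_eventually_comap {κ : Type*} [Finite κ] {x : X} (v : E.Fiber x)
    (e : κ → E.Fiber x) {P : E.Total → Prop}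
    (h : ∀ᶠ t in comap (fun t : Σ y, E.Fiber y × (κ → E.Fiber y) =>
      ((⟨t.1, t.2.1⟩ : E.Total), fun k => (⟨t.1, t.2.2 k⟩ : E.Total)))
      (𝓝 (⟨x, v⟩, fun k => ⟨x, e k⟩)), P ⟨t.1, t.2.1⟩) :
    ∀ᶠ q in 𝓝 (⟨x, v⟩ : E.Total), P q := by
  obtain ⟨S, hS, hSP⟩ := mem_comap.1 h
  obtain ⟨W, hW, U, hU, hWU⟩ := mem_nhds_prod_iff.1 hS
  rw [nhds_pi, Filter.mem_pi] at hU
  obtain ⟨I, hI, U', hU', hUU⟩ := hU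
  -- Openness of the projection: every fibre over a point near `x` meets each `U' k`.
  have h1 : ∀ k, TotalSpace.proj '' U' k ∈ 𝓝 x := fun k =>
    E.isOpenMap_proj.image_mem_nhds (hU' k)
  have h2 : ∀ᶠ q in 𝓝 (⟨x, v⟩ : E.Total), ∀ k, q.proj ∈ TotalSpace.proj '' U' k :=
    eventually_all.2 fun k => E.continuous_proj.continuousAt (h1 k)
  filter_upwards [hW, h2] with q hqW hq
  obtain ⟨y, a⟩ := q
  have h3 : ∀ k, ∃ s : E.Fiber y, (⟨y, s⟩ : E.Total) ∈ U' k := fun k => by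
    obtain ⟨⟨y', s⟩, hs, rfl⟩ := hq k
    exact ⟨s, hs⟩
  choose s hs using h3
  exact hSP (a := ⟨y, a, s⟩) (hWU (Set.mk_mem_prod hqW (hUU fun k _ => hs k)))

end LinearBundle

/-- Nearby fibres are compared with `𝕜 ^ n` through frames close to a basis of the fibre over `x`.
The frames are chosen point by point, so no local trivialization or continuous section through the
basis is needed. -/
theorem BanachNorm.continuous_norm_of_isExtremal (N : BanachNorm E) (hn : E.IsHomogeneous n)
    {B : ∀ x, E.Fiber x ≃ₗ[𝕜] EuclideanSpace 𝕜 (Fin n)} (hB : ∀ x, IsExtremal (N.nrm x) (B x)) :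
    Continuous fun p : E.Total => ‖B p.proj p.snd‖ := by
  rw [continuous_iff_continuousAt]
  rintro ⟨x, v⟩
  let e : Fin n → E.Fiber x := fun i => (B x).symm (EuclideanSpace.basisFun (Fin n) 𝕜 i)
  -- A point of this filter is a base point `y`, a vector over `y` near `v`, and an `n`-tuple over
  -- `y` near the basis `e`.
  let l := comap (fun t : Σ y, E.Fiber y × (Fin n → E.Fiber y) =>
      ((⟨t.1, t.2.1⟩ : E.Total), fun k => (⟨t.1, t.2.2 k⟩ : E.Total)))
      (𝓝 (⟨x, v⟩, fun k => ⟨x, e k⟩))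
  suffices h : Tendsto (fun t : Σ y, E.Fiber y × (Fin n → E.Fiber y) => ‖B t.1 t.2.1‖) l
      (𝓝 ‖B x v‖) from fun s hs =>
    E.eventually_nhds_of_eventually_comap v e (P := fun q => ‖B q.proj q.snd‖ ∈ s) (h hs)
  have hl := tendsto_comap (f := fun t : Σ y, E.Fiber y × (Fin n → E.Fiber y) =>
      ((⟨t.1, t.2.1⟩ : E.Total), fun k => (⟨t.1, t.2.2 k⟩ : E.Total)))
      (x := 𝓝 (⟨x, v⟩, fun k => ⟨x, e k⟩))
  have hv : Tendsto (fun t : Σ y, E.Fiber y × (Fin n → E.Fiber y) => (⟨t.1, t.2.1⟩ : E.Total)) l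
      (𝓝 ⟨x, v⟩) := (continuous_fst.tendsto _).comp hl
  have he : ∀ k, Tendsto (fun t : Σ y, E.Fiber y × (Fin n → E.Fiber y) =>
      (⟨t.1, t.2.2 k⟩ : E.Total)) l (𝓝 ⟨x, e k⟩) := fun k =>
    (((continuous_apply k).comp continuous_snd).tendsto _).comp hl
  have hy : Tendsto (fun t : Σ y, E.Fiber y × (Fin n → E.Fiber y) => t.1) l (𝓝 x) :=
    (E.continuous_proj.tendsto (⟨x, v⟩ : E.Total)).comp hv
  let A : ∀ t : Σ y, E.Fiber y × (Fin n → E.Fiber y),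
      EuclideanSpace 𝕜 (Fin n) →ₗ[𝕜] E.Fiber t.1 := fun t =>
    (Fintype.linearCombination 𝕜 t.2.2) ∘ₗ (WithLp.linearEquiv 2 𝕜 (Fin n → 𝕜)).toLinearMap
  have hA : ∀ c, Tendsto (fun t => (⟨t.1, A t c⟩ : E.Total)) l (𝓝 ⟨x, (B x).symm c⟩) := fun c => by
    have h1 : (B x).symm c = ∑ i, c i • e i := by
      conv_lhs => rw [← (EuclideanSpace.basisFun (Fin n) 𝕜).sum_repr c]
      simp [e]
    rw [h1]
    exact E.tendsto_sum Finset.univ hy fun k _ => E.tendsto_const_smul (c k) (he k)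
  have hnrm : ∀ {s : ∀ t : Σ y, E.Fiber y × (Fin n → E.Fiber y), E.Fiber t.1} {a : E.Fiber x},
      Tendsto (fun t => (⟨t.1, s t⟩ : E.Total)) l (𝓝 ⟨x, a⟩) →
      Tendsto (fun t => N.nrm t.1 (s t)) l (𝓝 (N.nrm x a)) := fun {s a} hs =>
    (N.continuous_nrm.tendsto (⟨x, a⟩ : E.Total)).comp hs
  let p : Seminorm 𝕜 (EuclideanSpace 𝕜 (Fin n)) :=
    (N.nrm x).comp ((B x).symm : EuclideanSpace 𝕜 (Fin n) →ₗ[𝕜] E.Fiber x)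
  have hp : ∀ c, p c = 0 → c = 0 := fun c hc =>
    (B x).symm.map_eq_zero_iff.1 (N.eq_zero x _ hc)
  have hq : ∀ c, Tendsto (fun t => (N.nrm t.1).comp (A t) c) l (𝓝 (p c)) := fun c => hnrm (hA c)
  have hext : ∀ᶠ t in l, ∃ φ : EuclideanSpace 𝕜 (Fin n) ≃ₗ[𝕜] EuclideanSpace 𝕜 (Fin n),
      IsExtremal ((N.nrm t.1).comp (A t)) φ ∧
      (φ : EuclideanSpace 𝕜 (Fin n) →ₗ[𝕜] EuclideanSpace 𝕜 (Fin n)) =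
        (B t.1 : E.Fiber t.1 →ₗ[𝕜] EuclideanSpace 𝕜 (Fin n)) ∘ₗ A t := by
    -- The pulled-back norm is eventually at least `p / 2`, so `A t` is injective and, by dimension,
    -- a linear equivalence; extremality then transports along it.
    filter_upwards [eventually_mul_le_of_tendsto hp hq (one_half_pos (α := ℝ))] with t ht
    have hinj : Function.Injective (A t) := by
      rw [← LinearMap.ker_eq_bot, LinearMap.ker_eq_bot']
      intro c hc
      refine hp c (le_antisymm ?_ (apply_nonneg p c))
      have h1 : (1 - 1 / 2) * p c ≤ N.nrm t.1 (A t c) := ht c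
      rw [hc, map_zero] at h1
      linarith
    have := (hn t.1).1
    let φ := LinearEquiv.ofInjectiveOfFinrankEq (A t) hinj
      (finrank_euclideanSpace_fin.trans (hn t.1).2.symm)
    exact ⟨φ.trans (B t.1), (hB t.1).comp φ, rfl⟩
  have hlim := tendsto_norm_of_isExtremal hp hq ((hB x).comp (B x).symm) hext (B x v)
  have hlim' : Tendsto (fun t => ‖B t.1 (A t (B x v))‖) l (𝓝 ‖B x v‖) := by simpa using hlim
  have hdiff : Tendsto (fun t : Σ y, E.Fiber y × (Fin n → E.Fiber y) =>
      N.nrm t.1 (t.2.1 - A t (B x v))) l (𝓝 0) := by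
    have h1 := hnrm (E.tendsto_add hv (E.tendsto_const_smul (-1) (hA (B x v))))
    simpa [← sub_eq_add_neg] using h1
  -- `A t (B x v)` approximates the moving vector in the original norm, and domination carries the
  -- approximation over to the Löwner norm.
  have hdiff' : Tendsto (fun t : Σ y, E.Fiber y × (Fin n → E.Fiber y) =>
      ‖B t.1 t.2.1‖ - ‖B t.1 (A t (B x v))‖) l (𝓝 0) := by
    refine squeeze_zero_norm (fun t => ?_) hdiff
    rw [Real.norm_eq_abs]
    refine (abs_norm_sub_norm_le _ _).trans ?_
    rw [← map_sub]
    exact (hB t.1).dominated _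
  simpa using hdiff'.add hlim'

/-- The Löwner renorming of a Banach bundle with extremal maps `B`. -/
noncomputable def BanachNorm.lowner (N : BanachNorm E) (hn : E.IsHomogeneous n)
    (B : ∀ x, E.Fiber x ≃ₗ[𝕜] EuclideanSpace 𝕜 (Fin n)) (hB : ∀ x, IsExtremal (N.nrm x) (B x)) :
    BanachNorm E where
  nrm x := (normSeminorm 𝕜 (EuclideanSpace 𝕜 (Fin n))).comp
    (B x : E.Fiber x →ₗ[𝕜] EuclideanSpace 𝕜 (Fin n))
  eq_zero x v hv := (B x).map_eq_zero_iff.1 (norm_eq_zero.1 hv)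
  complete x a ha := by
    -- The constant `√n + 1` is used in place of `√n` so that it can be divided by even when `n =
    -- 0`.
    have hle : ∀ v, N.nrm x v ≤ (√n + 1) * ‖B x v‖ := fun v =>
      ((hB x).le_sqrt_mul v).trans
        (mul_le_mul_of_nonneg_right (by linarith) (norm_nonneg _))
    have hpos : 0 < √(n : ℝ) + 1 := by positivity
    obtain ⟨m, hm⟩ := N.complete x a fun ε hε => by
      obtain ⟨M, hM⟩ := ha (ε / (√n + 1)) (by positivity)
      refine ⟨M, fun i hi j hj => (hle _).trans_lt ?_⟩
      rw [mul_comm, ← lt_div_iff₀ hpos]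
      exact hM i hi j hj
    exact ⟨m, squeeze_zero (fun i => apply_nonneg _ _) (fun i => (hB x).dominated _) hm⟩
  continuous_nrm := N.continuous_norm_of_isExtremal hn hB
  nhds_zero x := by
    have hpos : 0 < √(n : ℝ) + 1 := by positivity
    refine (N.nhds_zero x).to_hasBasis (fun S hS => ?_) fun S hS => ?_
    · refine ⟨(S.1, S.2 / (√n + 1)), ⟨hS.1, div_pos hS.2 hpos⟩, fun p hp => ⟨hp.1, ?_⟩⟩
      refine ((hB p.proj).le_sqrt_mul p.snd).trans_lt ?_
      have h1 : ‖B p.proj p.snd‖ < S.2 / (√n + 1) := hp.2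
      rw [lt_div_iff₀ hpos] at h1
      nlinarith [norm_nonneg (B p.proj p.snd)]
    · exact ⟨S, hS, fun p hp => ⟨hp.1, ((hB p.proj).dominated p.snd).trans_lt hp.2⟩⟩

end LownerNorm

/-! ### Hilbert structure, bounded sections and the distance bound -/

section Main

variable {𝕜 : Type w} [RCLike 𝕜] {X : Type u} [TopologicalSpace X]
  {E : LinearBundle.{w, u, v} 𝕜 X} {n : ℕ}

theorem BanachNorm.lowner_isHilbert (N : BanachNorm E) (hn : E.IsHomogeneous n)
    (B : ∀ x, E.Fiber x ≃ₗ[𝕜] EuclideanSpace 𝕜 (Fin n)) (hB : ∀ x, IsExtremal (N.nrm x) (B x)) :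
    (N.lowner hn B hB).IsHilbert := fun x =>
  ⟨{ inner := fun a b => inner 𝕜 (B x a) (B x b)
     conj_inner_symm := fun a b => inner_conj_symm _ _
     re_inner_nonneg := fun a => inner_self_nonneg
     add_left := fun a b c => by simp [inner_add_left]
     smul_left := fun a b r => by simp [inner_smul_left]
     definite := fun a ha => (B x).map_eq_zero_iff.1 (inner_self_eq_zero.1 ha) },
   fun a => norm_eq_sqrt_re_inner (𝕜 := 𝕜) (B x a)⟩

/-- The supremum norm bounds the fibre norms of a section. -/
theorem nrm_le_norm_bddSections (N : BanachNorm E) (s : bddSections N) (x : X) :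
    N.nrm x (s.1 x) ≤ ‖s‖ :=
  le_ciSup s.2.2 x

/-- Two uniformly equivalent fibrewise norms on a bundle have the same bounded sections. -/
theorem exists_bddSections_equiv (N N' : BanachNorm E) {C C' : ℝ} (hC : 0 ≤ C) (hC' : 0 ≤ C')
    (h : ∀ x a, N'.nrm x a ≤ C * N.nrm x a) (h' : ∀ x a, N.nrm x a ≤ C' * N'.nrm x a) :
    ∃ T : bddSections N ≃L[X →ᵇ 𝕜] bddSections N',
      (∀ s x, (T s).1 x = s.1 x) ∧ distortion T ≤ C * C' := by
  have key : ∀ (M M' : BanachNorm E) (D : ℝ), (∀ x a, M'.nrm x a ≤ D * M.nrm x a) → 0 ≤ D →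
      ∀ s ∈ bddSections M, s ∈ bddSections M' := fun M M' D hD hD0 s hs => by
    obtain ⟨K, hK⟩ := hs.2
    refine ⟨hs.1, D * K, ?_⟩
    rintro _ ⟨x, rfl⟩
    exact (hD x _).trans (mul_le_mul_of_nonneg_left (hK ⟨x, rfl⟩) hD0)
  let T₀ : bddSections N ≃ₗ[X →ᵇ 𝕜] bddSections N' :=
    { toFun := fun s => ⟨s.1, key N N' C h hC s.1 s.2⟩
      invFun := fun s => ⟨s.1, key N' N C' h' hC' s.1 s.2⟩
      map_add' := fun _ _ => rfl
      map_smul' := fun _ _ => rfl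
      left_inv := fun _ => rfl
      right_inv := fun _ => rfl }
  have hT : ∀ s, ‖T₀ s‖ ≤ C * ‖s‖ := fun s =>
    Real.iSup_le (fun x => (h x _).trans
      (mul_le_mul_of_nonneg_left (nrm_le_norm_bddSections N s x) hC))
      (mul_nonneg hC (norm_nonneg s))
  have hT' : ∀ s, ‖T₀.symm s‖ ≤ C' * ‖s‖ := fun s =>
    Real.iSup_le (fun x => (h' x _).trans
      (mul_le_mul_of_nonneg_left (nrm_le_norm_bddSections N' s x) hC'))
      (mul_nonneg hC' (norm_nonneg s))
  refine ⟨{ T₀ with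
    continuous_toFun := AddMonoidHomClass.continuous_of_bound T₀ C hT
    continuous_invFun := AddMonoidHomClass.continuous_of_bound T₀.symm C' hT' },
    fun _ _ => rfl, ?_⟩
  exact mul_le_mul (ContinuousLinearMap.opNorm_le_bound _ hC hT)
    (ContinuousLinearMap.opNorm_le_bound _ hC' hT') (norm_nonneg _) hC

/-- The identity renorming. -/
def Renorming.refl (E : LinearBundle.{w, u, v} 𝕜 X) : Renorming E E where
  fiberEquiv x := LinearEquiv.refl 𝕜 (E.Fiber x)
  continuous_toFun := continuous_id
  continuous_invFun := continuous_id

/-- The total space is unchanged, so the identity is an admissible renorming inducing `T`. The case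
`n = 0` is included: there `√n = 0` and the bound is `⊥`. -/
theorem bddBanachMazurDist_le_half_log {N N' : BanachNorm E}
    {T : bddSections N ≃L[X →ᵇ 𝕜] bddSections N'} (hT : ∀ s x, (T s).1 x = s.1 x)
    (hd : distortion T ≤ √n) :
    bddBanachMazurDist N N' ≤ ((1 / 2 : ℝ) : EReal) * ENNReal.log (n : ℝ≥0∞) := by
  rw [← ENNReal.log_rpow]
  refine ENNReal.log_le_log ?_
  refine (iInf_le_of_le (Renorming.refl E) (iInf_le_of_le T (iInf_le _ hT))).trans
    ((ENNReal.ofReal_le_ofReal hd).trans (le_of_eq ?_))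
  rw [Real.sqrt_eq_rpow, ← ENNReal.ofReal_rpow_of_nonneg (Nat.cast_nonneg n) (by norm_num),
    ENNReal.ofReal_natCast]

end Main

theorem mainTheorem2 {𝕜 : Type w} [RCLike 𝕜] {X : Type u} [TopologicalSpace X] [T2Space X]
    (hX : LocallyParacompact X) (n : ℕ) (E : LinearBundle.{w, u, v} 𝕜 X) (N : BanachNorm E)
    (hn : E.IsHomogeneous n) :
    (∃ N' : BanachNorm E, N'.IsHilbert ∧
      (∀ x, IsLownerEllipsoid 𝕜 (N.unitBall x) (N'.unitBall x) ∧
        ∀ L, IsLownerEllipsoid 𝕜 (N.unitBall x) L → L = N'.unitBall x) ∧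
      (∃ T : bddSections N ≃L[X →ᵇ 𝕜] bddSections N',
        (∀ s x, (T s).1 x = s.1 x) ∧ distortion T ≤ Real.sqrt n) ∧
      bddBanachMazurDist N N' ≤ ((1 / 2 : ℝ) : EReal) * ENNReal.log (n : ℝ≥0∞)) ∧
    (⨅ (E' : LinearBundle.{w, u, v} 𝕜 X) (N' : BanachNorm E') (_ : N'.IsHilbert)
        (_ : E'.IsHomogeneous n), bddBanachMazurDist N N')
      ≤ ((1 / 2 : ℝ) : EReal) * ENNReal.log (n : ℝ≥0∞) := by
  have hex : ∀ x, ∃ B : E.Fiber x ≃ₗ[𝕜] EuclideanSpace 𝕜 (Fin n), IsExtremal (N.nrm x) B :=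
    fun x => by
      have := (hn x).1
      exact exists_isExtremal (hn x).2 (N.nrm x) (N.eq_zero x)
  choose B hB using hex
  obtain ⟨T, hT, hd⟩ := exists_bddSections_equiv N (N.lowner hn B hB) zero_le_one
    (Real.sqrt_nonneg n) (fun x a => by rw [one_mul]; exact (hB x).dominated a)
    (fun x a => (hB x).le_sqrt_mul a)
  rw [one_mul] at hd
  have hdist := bddBanachMazurDist_le_half_log hT hd
  have hH := N.lowner_isHilbert hn B hB
  refine ⟨⟨N.lowner hn B hB, hH, fun x => ⟨?_, fun L hL => ?_⟩, ⟨T, hT, hd⟩, hdist⟩, ?_⟩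
  · exact (hB x).isLownerEllipsoid (N.eq_zero x) (hn x).2
  · exact (hB x).eq_of_isLownerEllipsoid (N.eq_zero x) (hn x).2 hL
  -- The infimum is bounded by its value at `E` itself with the Löwner norm.
  · exact iInf_le_of_le E (iInf_le_of_le (N.lowner hn B hB)
      (iInf_le_of_le hH (iInf_le_of_le hn hdist)))
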